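/- Let $F$ be an algebraically closed field of characteristic zero, let $A$ be a $5$-dimensional $F$-vector space with basis $x_1,\dots,x_5$ and let $x_1^*,\dots,x_5^*$ be the dual basis of $A^*$. Definitions. A 3-Lie algebra is a vector space $L$ with an alternating trilinear bracket satisfying $[a,b,[c,d,e]]=[[a,b,c],d,e]+[c,[a,b,d],e]+[c,d,[a,b,e]]$. $A^1$ is the subalgebra generated by all brackets of $A$, and $Z(A)=\{z:[z,A,A]=0\}$. An involutive derivation is a linear $D:A\to A$ with $D[a,b,c]=[Da,b,c]+[a,Db,c]+[a,b,Dc]$ and $D^2=\mathrm{id}$. The semi-direct product $A\ltimes_{ad^*}A^*$ is $A\oplus A^*$ with the bracket $$\mu(a_1+\xi_1,a_2+\xi_2,a_3+\xi_3)=[a_1,a_2,a_3]+ad^*(a_1,a_2)\xi_3+ad^*(a_2,a_3)\xi_1+ad^*(a_3,a_1)\xi_2,$$ where $\langle ad^*(a,b)\xi,c\rangle=-\langle\xi,[a,b,c]\rangle$. A local cocycle 3-Lie bialgebra is a 3-Lie algebra $L$ with a linear map $\Delta=\Delta_1+\Delta_2+\Delta_3:L\to L\otimes L\otimes L$ such that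 the dual map $\Delta^*$ is a 3-Lie bracket on $L^*$ and $\Delta_1,\Delta_2,\Delta_3$ are $1$-cocycles for the representations $ad\otimes1\otimes1$, $1\otimes ad\otimes1$, $1\otimes1\otimes ad$ of $L$ on $L\otimes L\otimes L$, respectively; here $f:L\to V$ is a $1$-cocycle for $\rho$ if $f([a,b,c])=\rho(a,b)f(c)+\rho(b,c)f(a)+\rho(c,a)f(b)$. The wedge $a\wedge b\wedge c$ is the sum of the six permuted tensors $\pm\,\cdot\otimes\cdot\otimes\cdot$ with the signs of the permutations. Theorem. For $1\le j\le17$ and all $\alpha,\beta,s,t,u\in F$ let $\psi_j$ be the alternating trilinear operation and $\widetilde\Delta^j$ the linear map on $A\oplus A^*$ given by the list below (brackets of basis vectors that do not follow from a listed one by skew-symmetry, and values of $\widetilde\Delta^j$ on unlisted basis vectors, are zero), and let $[\,,\,,]_j$ be the operation on $A$ defined by the listed values $\psi_j(x_a,x_b,x_c)$. Then: (i) $(A,[\,,\,,]_j)$ is a $5$-dimensional 3-Lie algebra with $\dim A^1\le3$, or with $\dim A^1=4$ and $Z(A)\ne0$; (ii) $\psi_j$ is the bracket of the $10$-dimensional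 semi-direct product 3-Lie algebra $A\ltimes_{ad^*}A^*$ of $(A,[\,,\,,]_j)$; (iii) there is an involutive derivation $D$ of $(A,[\,,\,,]_j)$ such that $(A\ltimes_{ad^*}A^*,\psi_j,\widetilde\Delta^j)$ is a local cocycle 3-Lie bialgebra with $\widetilde\Delta^j=\Delta_1+\Delta_2+\Delta_3$, where for $v\in A\oplus A^*$ $$\Delta_1(v)=\sum_{i,k=1}^5\big(\psi_j(v,x_i^*,-Dx_k)\otimes x_k^*\otimes Dx_i+\psi_j(v,-Dx_i,x_k^*)\otimes Dx_k\otimes x_i^*+\psi_j(v,Dx_i,Dx_k)\otimes x_k^*\otimes x_i^*\big),$$ and $\Delta_2,\Delta_3$ arise from $\Delta_1$ by applying $a\otimes b\otimes c\mapsto c\otimes a\otimes b$ and $a\otimes b\otimes c\mapsto b\otimes c\otimes a$, respectively. The list: (1) $\psi_{1}(x_2,x_3,x_4)=x_1$, $\psi_{1}(x_2,x_3,x_1^*)=-x_4^*$, $\psi_{1}(x_3,x_4,x_1^*)=-x_2^*$, $\psi_{1}(x_2,x_4,x_1^*)=x_3^*$; $\widetilde\Delta^{1}(x_2)=x_1\wedge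 x_3^*\wedge x_4^*$, $\widetilde\Delta^{1}(x_3)=x_1\wedge x_4^*\wedge x_2^*$, $\widetilde\Delta^{1}(x_4)=x_1\wedge x_2^*\wedge x_3^*$, $\widetilde\Delta^{1}(x_1^*)=x_2^*\wedge x_4^*\wedge x_3^*$. (2) $\psi_{2}(x_2,x_3,x_4)=x_1$, $\psi_{2}(x_3,x_4,x_5)=x_2$, $\psi_{2}(x_2,x_3,x_1^*)=-x_4^*$, $\psi_{2}(x_2,x_4,x_1^*)=x_3^*$, $\psi_{2}(x_3,x_4,x_1^*)=-x_2^*$, $\psi_{2}(x_3,x_4,x_2^*)=-x_5^*$, $\psi_{2}(x_4,x_5,x_2^*)=-x_3^*$, $\psi_{2}(x_3,x_5,x_2^*)=x_4^*$; $\widetilde\Delta^{2}(x_2)=x_1\wedge x_3^*\wedge x_4^*$, $\widetilde\Delta^{2}(x_3)=x_1\wedge x_4^*\wedge x_2^*+x_2\wedge x_4^*\wedge x_5^*$, $\widetilde\Delta^{2}(x_4)=x_1\wedge x_2^*\wedge x_3^*+x_5^*\wedge x_3^*\wedge x_2$, $\widetilde\Delta^{2}(x_5)=x_2\wedge x_3^*\wedge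 x_4^*$, $\widetilde\Delta^{2}(x_1^*)=x_2^*\wedge x_4^*\wedge x_3^*$, $\widetilde\Delta^{2}(x_2^*)=x_3^*\wedge x_5^*\wedge x_4^*$. (3) $\psi_{3}(x_2,x_3,x_4)=x_1$, $\psi_{3}(x_2,x_4,x_5)=x_2$, $\psi_{3}(x_1,x_4,x_5)=x_1$, $\psi_{3}(x_2,x_3,x_1^*)=-x_4^*$, $\psi_{3}(x_2,x_4,x_1^*)=x_3^*$, $\psi_{3}(x_3,x_4,x_1^*)=-x_2^*$, $\psi_{3}(x_2,x_4,x_2^*)=-x_5^*$, $\psi_{3}(x_2,x_5,x_2^*)=x_4^*$, $\psi_{3}(x_4,x_5,x_2^*)=-x_2^*$, $\psi_{3}(x_1,x_4,x_1^*)=-x_5^*$, $\psi_{3}(x_4,x_5,x_1^*)=-x_1^*$, $\psi_{3}(x_1,x_5,x_1^*)=x_4^*$; $\widetilde\Delta^{3}(x_1)=x_1\wedge x_4^*\wedge x_5^*$, $\widetilde\Delta^{3}(x_2)=x_1\wedge x_3^*\wedge x_4^*+x_2\wedge x_4^*\wedge x_5^*$, $\widetilde\Delta^{3}(x_3)=x_1\wedge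 x_4^*\wedge x_2^*$, $\widetilde\Delta^{3}(x_4)=x_1\wedge x_2^*\wedge x_3^*+x_2\wedge x_5^*\wedge x_2^*+x_5^*\wedge x_1^*\wedge x_1$, $\widetilde\Delta^{3}(x_5)=x_2^*\wedge x_4^*\wedge x_2+x_1^*\wedge x_4^*\wedge x_1$, $\widetilde\Delta^{3}(x_1^*)=x_1^*\wedge x_5^*\wedge x_4^*+x_2^*\wedge x_4^*\wedge x_3^*$, $\widetilde\Delta^{3}(x_2^*)=x_2^*\wedge x_5^*\wedge x_4^*$. (4) $\psi_{4}(x_2,x_3,x_4)=\alpha x_1+x_2$, $\psi_{4}(x_1,x_3,x_4)=x_2$, $\psi_{4}(x_2,x_4,x_5)=x_2$, $\psi_{4}(x_1,x_4,x_5)=x_1$, $\psi_{4}(x_2,x_3,x_1^*)=-\alpha x_4^*$, $\psi_{4}(x_2,x_4,x_1^*)=\alpha x_3^*$, $\psi_{4}(x_3,x_4,x_1^*)=-\alpha x_2^*$, $\psi_{4}(x_2,x_3,x_2^*)=-x_4^*$, $\psi_{4}(x_2,x_4,x_2^*)=x_3^*-x_5^*$, $\psi_{4}(x_3,x_4,x_2^*)=-x_2^*-x_1^*$,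 $\psi_{4}(x_1,x_3,x_2^*)=-x_4^*$, $\psi_{4}(x_1,x_4,x_2^*)=x_3^*$, $\psi_{4}(x_4,x_5,x_2^*)=-x_2^*$, $\psi_{4}(x_2,x_5,x_2^*)=x_4^*$, $\psi_{4}(x_1,x_4,x_1^*)=-x_5^*$, $\psi_{4}(x_4,x_5,x_1^*)=-x_1^*$, $\psi_{4}(x_1,x_5,x_1^*)=x_4^*$; $\widetilde\Delta^{4}(x_1)=x_2\wedge x_3^*\wedge x_4^*+x_1\wedge x_4^*\wedge x_5^*$, $\widetilde\Delta^{4}(x_2)=\alpha x_1\wedge x_3^*\wedge x_4^*+x_2\wedge x_3^*\wedge x_4^*+x_2\wedge x_4^*\wedge x_5^*$, $\widetilde\Delta^{4}(x_3)=\alpha x_1\wedge x_4^*\wedge x_2^*+x_2\wedge x_4^*\wedge x_2^*+x_2\wedge x_4^*\wedge x_1^*$, $\widetilde\Delta^{4}(x_4)=\alpha x_1\wedge x_2^*\wedge x_3^*+x_2\wedge x_2^*\wedge x_3^*+x_1^*\wedge x_3^*\wedge x_2+x_5^*\wedge x_2^*\wedge x_2+x_5^*\wedge x_1^*\wedge x_1$,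 $\widetilde\Delta^{4}(x_5)=x_2^*\wedge x_4^*\wedge x_2+x_1^*\wedge x_4^*\wedge x_1$, $\widetilde\Delta^{4}(x_1^*)=x_1^*\wedge x_5^*\wedge x_4^*+\alpha x_2^*\wedge x_4^*\wedge x_3^*$, $\widetilde\Delta^{4}(x_2^*)=x_2^*\wedge x_4^*\wedge x_3^*+x_1^*\wedge x_4^*\wedge x_3^*+x_2^*\wedge x_5^*\wedge x_4^*$. (5) $\psi_{5}(x_2,x_3,x_4)=\alpha x_1+x_2$, $\psi_{5}(x_1,x_3,x_4)=x_2$, $\psi_{5}(x_2,x_3,x_1^*)=-\alpha x_4^*$, $\psi_{5}(x_3,x_4,x_1^*)=-\alpha x_2^*$, $\psi_{5}(x_2,x_4,x_1^*)=\alpha x_3^*$, $\psi_{5}(x_2,x_3,x_2^*)=-x_4^*$, $\psi_{5}(x_2,x_4,x_2^*)=x_3^*$, $\psi_{5}(x_3,x_4,x_2^*)=-x_2^*-x_1^*$, $\psi_{5}(x_1,x_3,x_2^*)=-x_4^*$, $\psi_{5}(x_1,x_4,x_2^*)=x_3^*$; $\widetilde\Delta^{5}(x_1)=x_2\wedge x_3^*\wedge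 x_4^*$, $\widetilde\Delta^{5}(x_2)=\alpha x_1\wedge x_3^*\wedge x_4^*+x_2\wedge x_3^*\wedge x_4^*$, $\widetilde\Delta^{5}(x_3)=x_1^*\wedge x_2\wedge x_4^*+x_2\wedge x_4^*\wedge x_2^*+\alpha x_1\wedge x_4^*\wedge x_2^*$, $\widetilde\Delta^{5}(x_4)=x_1^*\wedge x_3^*\wedge x_2+\alpha x_1\wedge x_2^*\wedge x_3^*+x_2\wedge x_2^*\wedge x_3^*$, $\widetilde\Delta^{5}(x_1^*)=\alpha x_2^*\wedge x_4^*\wedge x_3^*$, $\widetilde\Delta^{5}(x_2^*)=x_1^*\wedge x_4^*\wedge x_3^*+x_2^*\wedge x_4^*\wedge x_3^*$. (6) $\psi_{6}(x_2,x_3,x_4)=x_1$, $\psi_{6}(x_1,x_3,x_4)=x_2$, $\psi_{6}(x_2,x_4,x_5)=x_2$, $\psi_{6}(x_1,x_4,x_5)=x_1$, $\psi_{6}(x_2,x_3,x_1^*)=-x_4^*$, $\psi_{6}(x_2,x_4,x_1^*)=x_3^*$, $\psi_{6}(x_3,x_4,x_1^*)=-x_2^*$, $\psi_{6}(x_1,x_3,x_2^*)=-x_4^*$,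 $\psi_{6}(x_3,x_4,x_2^*)=-x_1^*$, $\psi_{6}(x_1,x_4,x_2^*)=x_3^*$, $\psi_{6}(x_2,x_4,x_2^*)=-x_5^*$, $\psi_{6}(x_4,x_5,x_2^*)=-x_2^*$, $\psi_{6}(x_2,x_5,x_2^*)=x_4^*$, $\psi_{6}(x_1,x_4,x_1^*)=-x_5^*$, $\psi_{6}(x_4,x_5,x_1^*)=-x_1^*$, $\psi_{6}(x_1,x_5,x_1^*)=x_4^*$; $\widetilde\Delta^{6}(x_1)=x_1\wedge x_4^*\wedge x_5^*+x_2\wedge x_3^*\wedge x_4^*$, $\widetilde\Delta^{6}(x_2)=x_1\wedge x_3^*\wedge x_4^*+x_2\wedge x_4^*\wedge x_5^*$, $\widetilde\Delta^{6}(x_3)=x_1\wedge x_4^*\wedge x_2^*+x_2\wedge x_4^*\wedge x_1^*$, $\widetilde\Delta^{6}(x_4)=x_1\wedge x_2^*\wedge x_3^*+x_2\wedge x_1^*\wedge x_3^*+x_5^*\wedge x_2^*\wedge x_2+x_5^*\wedge x_1^*\wedge x_1$, $\widetilde\Delta^{6}(x_5)=x_2^*\wedge x_4^*\wedge x_2+x_1^*\wedge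 x_4^*\wedge x_1$, $\widetilde\Delta^{6}(x_1^*)=x_2^*\wedge x_4^*\wedge x_3^*+x_1^*\wedge x_5^*\wedge x_4^*$, $\widetilde\Delta^{6}(x_2^*)=x_1^*\wedge x_4^*\wedge x_3^*+x_2^*\wedge x_5^*\wedge x_4^*$. (7) $\psi_{7}(x_2,x_3,x_4)=x_1$, $\psi_{7}(x_2,x_4,x_5)=-x_2$, $\psi_{7}(x_3,x_4,x_5)=x_3$, $\psi_{7}(x_2,x_3,x_1^*)=-x_4^*$, $\psi_{7}(x_2,x_4,x_1^*)=x_3^*$, $\psi_{7}(x_3,x_4,x_1^*)=-x_2^*$, $\psi_{7}(x_2,x_4,x_2^*)=x_5^*$, $\psi_{7}(x_4,x_5,x_2^*)=x_2^*$, $\psi_{7}(x_2,x_5,x_2^*)=-x_4^*$, $\psi_{7}(x_3,x_4,x_3^*)=-x_5^*$, $\psi_{7}(x_4,x_5,x_3^*)=-x_3^*$, $\psi_{7}(x_3,x_5,x_3^*)=x_4^*$; $\widetilde\Delta^{7}(x_2)=x_1\wedge x_3^*\wedge x_4^*-x_2\wedge x_4^*\wedge x_5^*$, $\widetilde\Delta^{7}(x_3)=x_1\wedge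 x_4^*\wedge x_2^*+x_3\wedge x_4^*\wedge x_5^*$, $\widetilde\Delta^{7}(x_4)=x_1\wedge x_2^*\wedge x_3^*-x_2\wedge x_5^*\wedge x_2^*+x_3\wedge x_5^*\wedge x_3^*$, $\widetilde\Delta^{7}(x_5)=-x_2\wedge x_2^*\wedge x_4^*+x_3\wedge x_3^*\wedge x_4^*$, $\widetilde\Delta^{7}(x_1^*)=x_2^*\wedge x_4^*\wedge x_3^*$, $\widetilde\Delta^{7}(x_2^*)=-x_2^*\wedge x_5^*\wedge x_4^*$, $\widetilde\Delta^{7}(x_3^*)=x_3^*\wedge x_5^*\wedge x_4^*$. (8) $\psi_{8}(x_2,x_3,x_4)=x_2$, $\psi_{8}(x_1,x_3,x_4)=x_1$, $\psi_{8}(x_1,x_3,x_1^*)=-x_4^*$, $\psi_{8}(x_1,x_4,x_1^*)=x_3^*$, $\psi_{8}(x_3,x_4,x_1^*)=-x_1^*$, $\psi_{8}(x_2,x_3,x_2^*)=-x_4^*$, $\psi_{8}(x_2,x_4,x_2^*)=x_3^*$, $\psi_{8}(x_3,x_4,x_2^*)=-x_2^*$; $\widetilde\Delta^{8}(x_1)=x_1\wedge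 x_3^*\wedge x_4^*$, $\widetilde\Delta^{8}(x_2)=x_2\wedge x_3^*\wedge x_4^*$, $\widetilde\Delta^{8}(x_3)=x_1\wedge x_4^*\wedge x_1^*+x_2\wedge x_4^*\wedge x_2^*$, $\widetilde\Delta^{8}(x_4)=x_1\wedge x_1^*\wedge x_3^*+x_2\wedge x_2^*\wedge x_3^*$, $\widetilde\Delta^{8}(x_1^*)=x_1^*\wedge x_4^*\wedge x_3^*$, $\widetilde\Delta^{8}(x_2^*)=x_2^*\wedge x_4^*\wedge x_3^*$. (9) $\psi_{9}(x_2,x_3,x_4)=x_1$, $\psi_{9}(x_3,x_4,x_5)=x_3+\alpha x_2$, $\psi_{9}(x_2,x_4,x_5)=x_3$, $\psi_{9}(x_1,x_4,x_5)=x_1$, $\psi_{9}(x_2,x_3,x_1^*)=-x_4^*$, $\psi_{9}(x_2,x_4,x_1^*)=x_3^*$, $\psi_{9}(x_3,x_4,x_1^*)=-x_2^*$, $\psi_{9}(x_3,x_4,x_3^*)=-x_5^*$, $\psi_{9}(x_4,x_5,x_3^*)=-x_3^*-x_2^*$, $\psi_{9}(x_3,x_5,x_3^*)=x_4^*$, $\psi_{9}(x_3,x_4,x_2^*)=-\alpha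 x_5^*$, $\psi_{9}(x_4,x_5,x_2^*)=-\alpha x_3^*$, $\psi_{9}(x_3,x_5,x_2^*)=\alpha x_4^*$, $\psi_{9}(x_2,x_4,x_3^*)=-x_5^*$, $\psi_{9}(x_2,x_5,x_3^*)=x_4^*$, $\psi_{9}(x_1,x_4,x_1^*)=-x_5^*$, $\psi_{9}(x_4,x_5,x_1^*)=-x_1^*$, $\psi_{9}(x_1,x_5,x_1^*)=x_4^*$; $\widetilde\Delta^{9}(x_1)=x_1\wedge x_4^*\wedge x_5^*$, $\widetilde\Delta^{9}(x_2)=x_1\wedge x_3^*\wedge x_4^*+x_3\wedge x_4^*\wedge x_5^*$, $\widetilde\Delta^{9}(x_3)=x_1\wedge x_4^*\wedge x_2^*+\alpha x_2\wedge x_4^*\wedge x_5^*+x_3\wedge x_4^*\wedge x_5^*$, $\widetilde\Delta^{9}(x_4)=x_1\wedge x_2^*\wedge x_3^*+x_3\wedge x_5^*\wedge x_3^*+\alpha x_2\wedge x_5^*\wedge x_3^*+x_3\wedge x_5^*\wedge x_2^*+x_1\wedge x_5^*\wedge x_1^*$, $\widetilde\Delta^{9}(x_5)=x_3^*\wedge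 x_4^*\wedge x_3+\alpha x_3^*\wedge x_4^*\wedge x_2+x_2^*\wedge x_4^*\wedge x_3+x_1^*\wedge x_4^*\wedge x_1$, $\widetilde\Delta^{9}(x_1^*)=x_3^*\wedge x_2^*\wedge x_4^*+x_4^*\wedge x_1^*\wedge x_5^*$, $\widetilde\Delta^{9}(x_2^*)=\alpha x_4^*\wedge x_3^*\wedge x_5^*$, $\widetilde\Delta^{9}(x_3^*)=x_4^*\wedge x_3^*\wedge x_5^*+x_4^*\wedge x_2^*\wedge x_5^*$. (10) $\psi_{10}(x_2,x_3,x_4)=x_1$, $\psi_{10}(x_3,x_4,x_5)=x_3$, $\psi_{10}(x_2,x_4,x_5)=x_2$, $\psi_{10}(x_1,x_4,x_5)=2x_1$, $\psi_{10}(x_2,x_3,x_1^*)=-x_4^*$, $\psi_{10}(x_3,x_4,x_1^*)=-x_2^*$, $\psi_{10}(x_2,x_4,x_1^*)=x_3^*$, $\psi_{10}(x_3,x_4,x_3^*)=-x_5^*$, $\psi_{10}(x_4,x_5,x_3^*)=-x_3^*$, $\psi_{10}(x_3,x_5,x_3^*)=x_4^*$, $\psi_{10}(x_2,x_4,x_2^*)=-x_5^*$,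 $\psi_{10}(x_4,x_5,x_2^*)=-x_2^*$, $\psi_{10}(x_2,x_5,x_2^*)=x_4^*$, $\psi_{10}(x_1,x_4,x_1^*)=-2x_5^*$, $\psi_{10}(x_4,x_5,x_1^*)=-2x_1^*$, $\psi_{10}(x_1,x_5,x_1^*)=2x_4^*$; $\widetilde\Delta^{10}(x_1)=2x_1\wedge x_4^*\wedge x_5^*$, $\widetilde\Delta^{10}(x_2)=x_1\wedge x_3^*\wedge x_4^*+x_2\wedge x_4^*\wedge x_5^*$, $\widetilde\Delta^{10}(x_3)=x_1\wedge x_4^*\wedge x_2^*+x_3\wedge x_4^*\wedge x_5^*$, $\widetilde\Delta^{10}(x_4)=x_1\wedge x_2^*\wedge x_3^*+x_3\wedge x_5^*\wedge x_3^*+x_2\wedge x_5^*\wedge x_2^*+2x_1\wedge x_5^*\wedge x_1^*$, $\widetilde\Delta^{10}(x_5)=x_3\wedge x_3^*\wedge x_4^*+x_2\wedge x_2^*\wedge x_4^*+2x_1\wedge x_1^*\wedge x_4^*$, $\widetilde\Delta^{10}(x_1^*)=x_3^*\wedge x_2^*\wedge x_4^*+2x_4^*\wedge x_1^*\wedge x_5^*$,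 $\widetilde\Delta^{10}(x_2^*)=x_4^*\wedge x_2^*\wedge x_5^*$, $\widetilde\Delta^{10}(x_3^*)=x_4^*\wedge x_3^*\wedge x_5^*$. (11) $\psi_{11}(x_2,x_3,x_4)=x_1$, $\psi_{11}(x_1,x_3,x_4)=x_2$, $\psi_{11}(x_1,x_2,x_4)=x_3$, $\psi_{11}(x_2,x_3,x_1^*)=-x_4^*$, $\psi_{11}(x_3,x_4,x_1^*)=-x_2^*$, $\psi_{11}(x_2,x_4,x_1^*)=x_3^*$, $\psi_{11}(x_1,x_3,x_2^*)=-x_4^*$, $\psi_{11}(x_3,x_4,x_2^*)=-x_1^*$, $\psi_{11}(x_1,x_4,x_2^*)=x_3^*$, $\psi_{11}(x_1,x_4,x_3^*)=x_2^*$, $\psi_{11}(x_1,x_2,x_3^*)=-x_4^*$, $\psi_{11}(x_2,x_4,x_3^*)=-x_1^*$; $\widetilde\Delta^{11}(x_1)=x_2\wedge x_3^*\wedge x_4^*+x_3\wedge x_2^*\wedge x_4^*$, $\widetilde\Delta^{11}(x_2)=x_1\wedge x_3^*\wedge x_4^*+x_3\wedge x_4^*\wedge x_1^*$, $\widetilde\Delta^{11}(x_3)=x_1\wedge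 x_4^*\wedge x_2^*+x_2\wedge x_4^*\wedge x_1^*$, $\widetilde\Delta^{11}(x_4)=x_1\wedge x_2^*\wedge x_3^*+x_2\wedge x_1^*\wedge x_3^*+x_3\wedge x_1^*\wedge x_2^*$, $\widetilde\Delta^{11}(x_1^*)=x_3^*\wedge x_2^*\wedge x_4^*$, $\widetilde\Delta^{11}(x_2^*)=x_3^*\wedge x_1^*\wedge x_4^*$, $\widetilde\Delta^{11}(x_3^*)=x_2^*\wedge x_1^*\wedge x_4^*$. (12) $\psi_{12}(x_1,x_4,x_5)=x_1$, $\psi_{12}(x_2,x_4,x_5)=x_3$, $\psi_{12}(x_3,x_4,x_5)=\beta x_2+(1+\beta)x_3$, $\psi_{12}(x_1,x_4,x_1^*)=-x_5^*$, $\psi_{12}(x_4,x_5,x_1^*)=-x_1^*$, $\psi_{12}(x_1,x_5,x_1^*)=x_4^*$, $\psi_{12}(x_2,x_4,x_3^*)=-x_5^*$, $\psi_{12}(x_4,x_5,x_3^*)=-x_2^*-(1+\beta)x_3^*$, $\psi_{12}(x_2,x_5,x_3^*)=x_4^*$, $\psi_{12}(x_3,x_4,x_2^*)=-\beta x_5^*$,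 $\psi_{12}(x_4,x_5,x_2^*)=-\beta x_3^*$, $\psi_{12}(x_3,x_5,x_2^*)=\beta x_4^*$, $\psi_{12}(x_3,x_4,x_3^*)=-(1+\beta)x_5^*$, $\psi_{12}(x_3,x_5,x_3^*)=(1+\beta)x_4^*$; $\widetilde\Delta^{12}(x_1)=x_1\wedge x_4^*\wedge x_5^*$, $\widetilde\Delta^{12}(x_2)=x_3\wedge x_4^*\wedge x_5^*$, $\widetilde\Delta^{12}(x_3)=\beta x_2\wedge x_4^*\wedge x_5^*+(1+\beta)x_3\wedge x_4^*\wedge x_5^*$, $\widetilde\Delta^{12}(x_4)=x_1\wedge x_5^*\wedge x_1^*+x_3\wedge x_5^*\wedge x_2^*+\beta x_2\wedge x_5^*\wedge x_3^*+(1+\beta)x_3\wedge x_5^*\wedge x_3^*$, $\widetilde\Delta^{12}(x_5)=x_1\wedge x_1^*\wedge x_4^*+x_3\wedge x_2^*\wedge x_4^*+\beta x_2\wedge x_3^*\wedge x_4^*+(1+\beta)x_3\wedge x_3^*\wedge x_4^*$, $\widetilde\Delta^{12}(x_1^*)=x_4^*\wedge x_1^*\wedge x_5^*$, $\widetilde\Delta^{12}(x_2^*)=\beta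 x_4^*\wedge x_3^*\wedge x_5^*$, $\widetilde\Delta^{12}(x_3^*)=x_4^*\wedge x_2^*\wedge x_5^*+(1+\beta)x_4^*\wedge x_3^*\wedge x_5^*$. (13) $\psi_{13}(x_1,x_4,x_5)=x_1$, $\psi_{13}(x_2,x_4,x_5)=x_2$, $\psi_{13}(x_3,x_4,x_5)=x_3$, $\psi_{13}(x_1,x_4,x_1^*)=-x_5^*$, $\psi_{13}(x_4,x_5,x_1^*)=-x_1^*$, $\psi_{13}(x_1,x_5,x_1^*)=x_4^*$, $\psi_{13}(x_2,x_4,x_2^*)=-x_5^*$, $\psi_{13}(x_4,x_5,x_2^*)=-x_2^*$, $\psi_{13}(x_2,x_5,x_2^*)=x_4^*$, $\psi_{13}(x_3,x_4,x_3^*)=-x_5^*$, $\psi_{13}(x_4,x_5,x_3^*)=-x_3^*$, $\psi_{13}(x_3,x_5,x_3^*)=x_4^*$; $\widetilde\Delta^{13}(x_1)=x_1\wedge x_4^*\wedge x_5^*$, $\widetilde\Delta^{13}(x_2)=x_2\wedge x_4^*\wedge x_5^*$, $\widetilde\Delta^{13}(x_3)=x_3\wedge x_4^*\wedge x_5^*$,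 $\widetilde\Delta^{13}(x_4)=x_5^*\wedge x_1^*\wedge x_1+x_5^*\wedge x_2^*\wedge x_2+x_5^*\wedge x_3^*\wedge x_3$, $\widetilde\Delta^{13}(x_5)=x_1^*\wedge x_4^*\wedge x_1+x_2^*\wedge x_4^*\wedge x_2+x_3^*\wedge x_4^*\wedge x_3$, $\widetilde\Delta^{13}(x_1^*)=x_4^*\wedge x_1^*\wedge x_5^*$, $\widetilde\Delta^{13}(x_2^*)=x_4^*\wedge x_2^*\wedge x_5^*$, $\widetilde\Delta^{13}(x_3^*)=x_4^*\wedge x_3^*\wedge x_5^*$. (14) $\psi_{14}(x_1,x_4,x_5)=x_2$, $\psi_{14}(x_2,x_4,x_5)=x_3$, $\psi_{14}(x_3,x_4,x_5)=sx_1+tx_2+ux_3$, $\psi_{14}(x_1,x_4,x_2^*)=-x_5^*$, $\psi_{14}(x_4,x_5,x_2^*)=-x_1^*-tx_3^*$, $\psi_{14}(x_1,x_5,x_2^*)=x_4^*$, $\psi_{14}(x_2,x_4,x_3^*)=-x_5^*$, $\psi_{14}(x_4,x_5,x_3^*)=-x_2^*-ux_3^*$, $\psi_{14}(x_2,x_5,x_3^*)=x_4^*$,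 $\psi_{14}(x_3,x_4,x_1^*)=-sx_5^*$, $\psi_{14}(x_4,x_5,x_1^*)=-sx_3^*$, $\psi_{14}(x_3,x_5,x_1^*)=sx_4^*$, $\psi_{14}(x_3,x_4,x_2^*)=-tx_5^*$, $\psi_{14}(x_3,x_5,x_2^*)=tx_4^*$, $\psi_{14}(x_3,x_4,x_3^*)=-ux_5^*$, $\psi_{14}(x_3,x_5,x_3^*)=ux_4^*$; $\widetilde\Delta^{14}(x_1)=x_2\wedge x_4^*\wedge x_5^*$, $\widetilde\Delta^{14}(x_2)=x_3\wedge x_4^*\wedge x_5^*$, $\widetilde\Delta^{14}(x_3)=sx_1\wedge x_4^*\wedge x_5^*+tx_2\wedge x_4^*\wedge x_5^*+ux_3\wedge x_4^*\wedge x_5^*$, $\widetilde\Delta^{14}(x_4)=x_2\wedge x_5^*\wedge x_1^*+x_3\wedge x_5^*\wedge x_2^*+sx_1\wedge x_5^*\wedge x_3^*+tx_2\wedge x_5^*\wedge x_3^*+ux_3\wedge x_5^*\wedge x_3^*$, $\widetilde\Delta^{14}(x_5)=x_2\wedge x_1^*\wedge x_4^*+x_3\wedge x_2^*\wedge x_4^*+sx_1\wedge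 x_3^*\wedge x_4^*+tx_2\wedge x_3^*\wedge x_4^*+ux_3\wedge x_3^*\wedge x_4^*$, $\widetilde\Delta^{14}(x_1^*)=sx_4^*\wedge x_3^*\wedge x_5^*$, $\widetilde\Delta^{14}(x_2^*)=x_4^*\wedge x_1^*\wedge x_5^*+tx_4^*\wedge x_3^*\wedge x_5^*$, $\widetilde\Delta^{14}(x_3^*)=x_4^*\wedge x_2^*\wedge x_5^*+ux_4^*\wedge x_3^*\wedge x_5^*$. (15) $\psi_{15}(x_2,x_3,x_4)=x_1$, $\psi_{15}(x_1,x_3,x_4)=x_2$, $\psi_{15}(x_2,x_3,x_1^*)=-x_4^*$, $\psi_{15}(x_3,x_4,x_1^*)=-x_2^*$, $\psi_{15}(x_2,x_4,x_1^*)=x_3^*$, $\psi_{15}(x_1,x_3,x_2^*)=-x_4^*$, $\psi_{15}(x_3,x_4,x_2^*)=-x_1^*$, $\psi_{15}(x_1,x_4,x_2^*)=x_3^*$; $\widetilde\Delta^{15}(x_1)=x_2\wedge x_3^*\wedge x_4^*$, $\widetilde\Delta^{15}(x_2)=x_1\wedge x_3^*\wedge x_4^*$, $\widetilde\Delta^{15}(x_3)=x_1\wedge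 x_4^*\wedge x_2^*+x_1^*\wedge x_2\wedge x_4^*$, $\widetilde\Delta^{15}(x_4)=x_1\wedge x_2^*\wedge x_3^*+x_1^*\wedge x_3^*\wedge x_2$, $\widetilde\Delta^{15}(x_1^*)=x_2^*\wedge x_4^*\wedge x_3^*$, $\widetilde\Delta^{15}(x_2^*)=x_1^*\wedge x_4^*\wedge x_3^*$. (16) $\psi_{16}(x_2,x_3,x_4)=-x_2$, $\psi_{16}(x_1,x_3,x_4)=x_1$, $\psi_{16}(x_1,x_2,x_3)=x_3$, $\psi_{16}(x_1,x_2,x_4)=-x_4$, $\psi_{16}(x_2,x_3,x_2^*)=x_4^*$, $\psi_{16}(x_3,x_4,x_2^*)=x_2^*$, $\psi_{16}(x_2,x_4,x_2^*)=-x_3^*$, $\psi_{16}(x_1,x_3,x_1^*)=-x_4^*$, $\psi_{16}(x_3,x_4,x_1^*)=-x_1^*$, $\psi_{16}(x_1,x_4,x_1^*)=x_3^*$, $\psi_{16}(x_1,x_2,x_3^*)=-x_3^*$, $\psi_{16}(x_1,x_3,x_3^*)=x_2^*$, $\psi_{16}(x_2,x_3,x_3^*)=-x_1^*$, $\psi_{16}(x_1,x_2,x_4^*)=x_4^*$,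 $\psi_{16}(x_1,x_4,x_4^*)=-x_2^*$, $\psi_{16}(x_2,x_4,x_4^*)=x_1^*$; $\widetilde\Delta^{16}(x_1)=x_1\wedge x_3^*\wedge x_4^*+x_2^*\wedge x_3^*\wedge x_3+x_4^*\wedge x_2^*\wedge x_4$, $\widetilde\Delta^{16}(x_2)=x_3\wedge x_3^*\wedge x_1^*+x_4^*\wedge x_3^*\wedge x_2+x_4\wedge x_1^*\wedge x_4^*$, $\widetilde\Delta^{16}(x_3)=x_1^*\wedge x_2^*\wedge x_3+x_2^*\wedge x_4^*\wedge x_2+x_4^*\wedge x_1^*\wedge x_1$, $\widetilde\Delta^{16}(x_4)=x_1^*\wedge x_4\wedge x_2^*+x_1\wedge x_1^*\wedge x_3^*+x_2\wedge x_3^*\wedge x_2^*$, $\widetilde\Delta^{16}(x_1^*)=x_1^*\wedge x_4^*\wedge x_3^*$, $\widetilde\Delta^{16}(x_2^*)=x_2^*\wedge x_3^*\wedge x_4^*$, $\widetilde\Delta^{16}(x_3^*)=x_1^*\wedge x_3^*\wedge x_2^*$, $\widetilde\Delta^{16}(x_4^*)=x_1^*\wedge x_2^*\wedge x_4^*$.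 (17) $\psi_{17}(x_1,x_2,x_3)=x_1$, $\psi_{17}(x_1,x_2,x_1^*)=-x_3^*$, $\psi_{17}(x_2,x_3,x_1^*)=-x_1^*$, $\psi_{17}(x_1,x_3,x_1^*)=x_2^*$; $\widetilde\Delta^{17}(x_1)=x_1\wedge x_2^*\wedge x_3^*$, $\widetilde\Delta^{17}(x_2)=x_3^*\wedge x_1^*\wedge x_1$, $\widetilde\Delta^{17}(x_3)=x_1^*\wedge x_2^*\wedge x_1$, $\widetilde\Delta^{17}(x_1^*)=x_1^*\wedge x_3^*\wedge x_2^*$. -/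

import Mathlib

open scoped TensorProduct

/-- Trilinear operations `L × L × L → L`. -/
abbrev TernaryOp (F L : Type*) [Field F] [AddCommGroup L] [Module F L] : Type _ :=
  L →ₗ[F] L →ₗ[F] L →ₗ[F] L

/-- A trilinear operation is a 3-Lie bracket if it is alternating and satisfies the
Filippov (generalized Jacobi) identity. -/
structure IsThreeLieBracket {F L : Type*} [Field F] [AddCommGroup L] [Module F L]
    (b : TernaryOp F L) : Prop where
  alt_left : ∀ x y, b x x y = 0
  alt_right : ∀ x y, b x y y = 0
  alt_outer : ∀ x y, b x y x = 0
  filippov : ∀ x₁ x₂ x₃ x₄ x₅, b x₁ x₂ (b x₃ x₄ x₅) =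
    b (b x₁ x₂ x₃) x₄ x₅ + b x₃ (b x₁ x₂ x₄) x₅ + b x₃ x₄ (b x₁ x₂ x₅)

/-- The derived algebra `A¹`.  The span of all brackets is closed under the bracket, so it is
the subalgebra that the brackets generate. -/
def derivedAlgebra {F L : Type*} [Field F] [AddCommGroup L] [Module F L]
    (b : TernaryOp F L) : Submodule F L :=
  Submodule.span F {v | ∃ x y z, v = b x y z}

/-- The center `Z(A)`. -/
def threeLieCenter {F L : Type*} [Field F] [AddCommGroup L] [Module F L]
    (b : TernaryOp F L) : Submodule F L := LinearMap.ker b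

theorem mem_threeLieCenter {F L : Type*} [Field F] [AddCommGroup L] [Module F L]
    (b : TernaryOp F L) (z : L) : z ∈ threeLieCenter b ↔ ∀ x y, b z x y = 0 := by
  rw [threeLieCenter, LinearMap.mem_ker]
  constructor
  · intro h x y
    rw [h]
    rfl
  · intro h
    ext x y
    exact h x y

/-- `D` is a derivation with `D² = id`. -/
structure IsInvolutiveDerivation {F L : Type*} [Field F] [AddCommGroup L] [Module F L]
    (b : TernaryOp F L) (D : L →ₗ[F] L) : Prop where
  leibniz : ∀ x y z, D (b x y z) = b (D x) y z + b x (D y) z + b x y (D z)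
  involutive : ∀ x, D (D x) = x

/-- The coadjoint action `⟨ad*(x, y) ξ, z⟩ = -⟨ξ, [x, y, z]⟩`. -/
def coad {F A : Type*} [Field F] [AddCommGroup A] [Module F A]
    (b : TernaryOp F A) (x y : A) : Module.Dual F A →ₗ[F] Module.Dual F A :=
  -(b x y).dualMap

theorem coad_apply {F A : Type*} [Field F] [AddCommGroup A] [Module F A]
    (b : TernaryOp F A) (x y z : A) (ξ : Module.Dual F A) : coad b x y ξ z = -ξ (b x y z) := rfl

/-- The bracket of the semi-direct product `A ⋉_{ad*} A*` on `A × A*`. -/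
def semidirectBracket {F A : Type*} [Field F] [AddCommGroup A] [Module F A]
    (b : TernaryOp F A) : TernaryOp F (A × Module.Dual F A) :=
  LinearMap.mk₂ F
    (fun p q =>
      { toFun := fun r =>
          (b p.1 q.1 r.1, coad b p.1 q.1 r.2 + coad b q.1 r.1 p.2 + coad b r.1 p.1 q.2)
        map_add' := by
          intro r r'
          refine Prod.ext (by simp) (LinearMap.ext fun a => ?_)
          simp only [LinearMap.add_apply, coad_apply, Prod.fst_add, Prod.snd_add, map_add]
          ring
        map_smul' := by
          intro c r
          refine Prod.ext (by simp) (LinearMap.ext fun a => ?_)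
          simp only [LinearMap.add_apply, LinearMap.smul_apply, coad_apply, Prod.smul_fst,
            Prod.smul_snd, map_smul, smul_eq_mul, RingHom.id_apply]
          ring })
    (by
      intro p p' q
      refine LinearMap.ext fun r => Prod.ext (by simp) (LinearMap.ext fun a => ?_)
      simp only [LinearMap.coe_mk, AddHom.coe_mk, LinearMap.add_apply, coad_apply, Prod.fst_add,
        Prod.snd_add, map_add]
      ring)
    (by
      intro c p q
      refine LinearMap.ext fun r => Prod.ext (by simp) (LinearMap.ext fun a => ?_)
      simp only [LinearMap.coe_mk, AddHom.coe_mk, LinearMap.add_apply, LinearMap.smul_apply,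
        coad_apply, Prod.smul_fst, Prod.smul_snd, map_smul, smul_eq_mul]
      ring)
    (by
      intro p q q'
      refine LinearMap.ext fun r => Prod.ext (by simp) (LinearMap.ext fun a => ?_)
      simp only [LinearMap.coe_mk, AddHom.coe_mk, LinearMap.add_apply, coad_apply, Prod.fst_add,
        Prod.snd_add, map_add]
      ring)
    (by
      intro c p q
      refine LinearMap.ext fun r => Prod.ext (by simp) (LinearMap.ext fun a => ?_)
      simp only [LinearMap.coe_mk, AddHom.coe_mk, LinearMap.add_apply, LinearMap.smul_apply,
        coad_apply, Prod.smul_fst, Prod.smul_snd, map_smul, smul_eq_mul]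
      ring)

theorem semidirectBracket_apply {F A : Type*} [Field F] [AddCommGroup A] [Module F A]
    (b : TernaryOp F A) (p q r : A × Module.Dual F A) :
    semidirectBracket b p q r =
      (b p.1 q.1 r.1, coad b p.1 q.1 r.2 + coad b q.1 r.1 p.2 + coad b r.1 p.1 q.2) := rfl

/-- The tensor cube `L ⊗ L ⊗ L`. -/
abbrev TensorCube (F L : Type*) [Field F] [AddCommGroup L] [Module F L] : Type _ :=
  L ⊗[F] (L ⊗[F] L)

/-- `a ∧ b ∧ c`, the sum over all six permutations with signs (no factor `1/6`). -/
def wedge (F : Type*) {L : Type*} [Field F] [AddCommGroup L] [Module F L] (a b c : L) :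
    TensorCube F L :=
  a ⊗ₜ[F] (b ⊗ₜ[F] c) + b ⊗ₜ[F] (c ⊗ₜ[F] a) + c ⊗ₜ[F] (a ⊗ₜ[F] b)
    - b ⊗ₜ[F] (a ⊗ₜ[F] c) - a ⊗ₜ[F] (c ⊗ₜ[F] b) - c ⊗ₜ[F] (b ⊗ₜ[F] a)

/-- The exchange of the first and second tensor factors. -/
def phi12 (F L : Type*) [Field F] [AddCommGroup L] [Module F L] :
    TensorCube F L →ₗ[F] TensorCube F L :=
  (TensorProduct.leftComm F L L L).toLinearMap

/-- The exchange of the first and third tensor factors. -/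
def phi13 (F L : Type*) [Field F] [AddCommGroup L] [Module F L] :
    TensorCube F L →ₗ[F] TensorCube F L :=
  phi12 F L ∘ₗ (TensorProduct.comm F L L).toLinearMap.lTensor L ∘ₗ phi12 F L

theorem phi12_tmul (F : Type*) {L : Type*} [Field F] [AddCommGroup L] [Module F L] (a b c : L) :
    phi12 F L (a ⊗ₜ[F] (b ⊗ₜ[F] c)) = b ⊗ₜ[F] (a ⊗ₜ[F] c) := by
  simp [phi12]

theorem phi13_tmul (F : Type*) {L : Type*} [Field F] [AddCommGroup L] [Module F L] (a b c : L) :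
    phi13 F L (a ⊗ₜ[F] (b ⊗ₜ[F] c)) = c ⊗ₜ[F] (b ⊗ₜ[F] a) := by
  simp [phi13, phi12]

/-- The dual operation `Δ* : L* × L* × L* → L*`,
`⟨Δ*(ξ, η, ζ), x⟩ = ⟨ξ ⊗ η ⊗ ζ, Δ x⟩`. -/
def dualOperation {F L : Type*} [Field F] [AddCommGroup L] [Module F L]
    (Δ : L →ₗ[F] TensorCube F L) : TernaryOp F (Module.Dual F L) :=
  LinearMap.mk₂ F
    (fun ξ η => Δ.dualMap ∘ₗ TensorProduct.dualDistrib F L (L ⊗[F] L) ∘ₗ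
      TensorProduct.mk F (Module.Dual F L) (Module.Dual F (L ⊗[F] L)) ξ ∘ₗ
      TensorProduct.dualDistrib F L L ∘ₗ
      TensorProduct.mk F (Module.Dual F L) (Module.Dual F L) η)
    (by
      intro ξ ξ' η
      ext
      simp)
    (by
      intro c ξ η
      ext ζ x
      simp only [LinearMap.comp_apply, LinearMap.smul_apply, map_smul])
    (by
      intro ξ η η'
      ext
      simp [TensorProduct.tmul_add])
    (by
      intro c ξ η
      ext ζ x
      simp only [LinearMap.comp_apply, LinearMap.smul_apply, map_smul])

theorem dualOperation_apply {F L : Type*} [Field F] [AddCommGroup L] [Module F L]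
    (Δ : L →ₗ[F] TensorCube F L) (ξ η ζ : Module.Dual F L) (x : L) :
    dualOperation Δ ξ η ζ x = TensorProduct.dualDistrib F L (L ⊗[F] L)
      (ξ ⊗ₜ[F] TensorProduct.dualDistrib F L L (η ⊗ₜ[F] ζ)) (Δ x) := rfl

/-- `f : L → V` is a 1-cocycle of the 3-Lie algebra `(L, b)` with values in the
representation `ρ` of `L` on `V`. -/
def IsOneCocycle {F L V : Type*} [Field F] [AddCommGroup L] [Module F L]
    [AddCommGroup V] [Module F V] (b : TernaryOp F L) (ρ : L → L → V →ₗ[F] V)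
    (f : L →ₗ[F] V) : Prop :=
  ∀ x y z, f (b x y z) = ρ x y (f z) + ρ y z (f x) + ρ z x (f y)

/-- `(L, b, Δ)`, with the decomposition `Δ = Δ₁ + Δ₂ + Δ₃`, is a local cocycle 3-Lie bialgebra;
the three cocycle conditions refer to the representations `ad ⊗ 1 ⊗ 1`, `1 ⊗ ad ⊗ 1` and
`1 ⊗ 1 ⊗ ad` on `L ⊗ L ⊗ L`, where `ad(x, y) = b x y`. -/
structure IsLocalCocycleBialgebra {F L : Type*} [Field F] [AddCommGroup L] [Module F L]
    (b : TernaryOp F L) (Δ Δ₁ Δ₂ Δ₃ : L →ₗ[F] TensorCube F L) : Prop where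
  threeLie : IsThreeLieBracket b
  decomposition : Δ = Δ₁ + Δ₂ + Δ₃
  dual_threeLie : IsThreeLieBracket (dualOperation Δ)
  cocycle₁ : IsOneCocycle b (fun x y => (b x y).rTensor (L ⊗[F] L)) Δ₁
  cocycle₂ : IsOneCocycle b (fun x y => ((b x y).rTensor L).lTensor L) Δ₂
  cocycle₃ : IsOneCocycle b (fun x y => ((b x y).lTensor L).lTensor L) Δ₃

/-- The map `Δ₁` on the semi-direct product `A ⋉_{ad*} A*` with bracket `μ` that an
endomorphism `D` of `A` induces:
`Δ₁(v) = ∑ μ(v, x_i*, -D x_j) ⊗ x_j* ⊗ D x_i + ∑ μ(v, -D x_i, x_j*) ⊗ D x_j ⊗ x_i*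
  + ∑ μ(v, D x_i, D x_j) ⊗ x_j* ⊗ x_i*`. -/
noncomputable def inducedDelta₁ {F A ι : Type*} [Field F] [AddCommGroup A] [Module F A]
    [Fintype ι] [DecidableEq ι] (x : Module.Basis ι F A) (b : TernaryOp F A) (D : A →ₗ[F] A) :
    (A × Module.Dual F A) →ₗ[F] TensorCube F (A × Module.Dual F A) :=
  let μ := semidirectBracket b
  let DX : ι → A × Module.Dual F A := fun i => (D (x i), 0)
  let Y : ι → A × Module.Dual F A := fun i => (0, x.dualBasis i)
  { toFun := fun v => ∑ i, ∑ j,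
      (μ v (Y i) (-DX j) ⊗ₜ[F] (Y j ⊗ₜ[F] DX i)
        + μ v (-DX i) (Y j) ⊗ₜ[F] (DX j ⊗ₜ[F] Y i)
        + μ v (DX i) (DX j) ⊗ₜ[F] (Y j ⊗ₜ[F] Y i))
    map_add' := by
      intro v w
      simp only [map_add, LinearMap.add_apply, TensorProduct.add_tmul, ← Finset.sum_add_distrib]
      refine Finset.sum_congr rfl fun i _ => Finset.sum_congr rfl fun j _ => ?_
      abel
    map_smul' := by
      intro c v
      simp only [map_smul, LinearMap.smul_apply, ← TensorProduct.smul_tmul', Finset.smul_sum,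
        smul_add, RingHom.id_apply] }

/-- `Δ₂ = φ₁₃ φ₁₂ Δ₁`. -/
noncomputable def inducedDelta₂ {F A ι : Type*} [Field F] [AddCommGroup A] [Module F A]
    [Fintype ι] [DecidableEq ι] (x : Module.Basis ι F A) (b : TernaryOp F A) (D : A →ₗ[F] A) :
    (A × Module.Dual F A) →ₗ[F] TensorCube F (A × Module.Dual F A) :=
  phi13 F _ ∘ₗ phi12 F _ ∘ₗ inducedDelta₁ x b D

/-- `Δ₃ = φ₁₂ φ₁₃ Δ₁`. -/
noncomputable def inducedDelta₃ {F A ι : Type*} [Field F] [AddCommGroup A] [Module F A]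
    [Fintype ι] [DecidableEq ι] (x : Module.Basis ι F A) (b : TernaryOp F A) (D : A →ₗ[F] A) :
    (A × Module.Dual F A) →ₗ[F] TensorCube F (A × Module.Dual F A) :=
  phi12 F _ ∘ₗ phi13 F _ ∘ₗ inducedDelta₁ x b D

/-- The alternating trilinear operation `(f ∧ g ∧ h) • v`. -/
def altMonomial {F L : Type*} [Field F] [AddCommGroup L] [Module F L]
    (f g h : Module.Dual F L) (v : L) : TernaryOp F L :=
  let m : Module.Dual F L → Module.Dual F L → Module.Dual F L → TernaryOp F L :=
    fun p q r => p.smulRight (q.smulRight (r.smulRight v))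
  m f g h + m g h f + m h f g - m g f h - m f h g - m h g f

theorem altMonomial_apply {F L : Type*} [Field F] [AddCommGroup L] [Module F L]
    (f g h : Module.Dual F L) (v a b c : L) :
    altMonomial f g h v a b c = (f a * g b * h c + g a * h b * f c + h a * f b * g c
      - g a * f b * h c - f a * h b * g c - h a * g b * f c) • v := by
  simp [altMonomial, sub_smul, add_smul, mul_smul]

/-- The alternating trilinear operation with the multiplication table `T`: an entry
`(i, j, k, v)` stands for `[e_i, e_j, e_k] = v`, several entries with the same `i, j, k` add up,
and brackets of basis vectors that do not follow from an entry by skew-symmetry vanish. -/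
noncomputable def tableOperation {F L ι : Type*} [Field F] [AddCommGroup L] [Module F L]
    (e : Module.Basis ι F L) (T : List (ι × ι × ι × L)) : TernaryOp F L :=
  (T.map fun r => altMonomial (e.coord r.1) (e.coord r.2.1) (e.coord r.2.2.1) r.2.2.2).sum

/-- The label `n ∈ {1, …, 5}` as an element of the index set `Fin 5 = {0, …, 4}`. -/
def lab (n : ℕ) : Fin 5 := Fin.ofNat 5 (n - 1)

/-- A bracket on `A`, together with a bracket and a coproduct on `A × A*`. -/
structure ExplicitData (F A : Type*) [Field F] [AddCommGroup A] [Module F A] where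
  bracket : TernaryOp F A
  psi : TernaryOp F (A × Module.Dual F A)
  coproduct : (A × Module.Dual F A) →ₗ[F] TensorCube F (A × Module.Dual F A)

/-- The data given by tables.  An entry `(i, j, k, v)` of `T` stands for `ψ(x_i, x_j, x_k) = v`,
an entry `(i, j, k, ξ)` of `S` for `ψ(x_i, x_j, x_k*) = ξ`, with `x_1, …, x_5` the basis of `A` and
`x_1*, …, x_5*` the dual basis.  The vectors `ΔX` and `ΔY` list the values of the coproduct
on `x_1, …, x_5` and on `x_1*, …, x_5*`. -/
noncomputable def ofTables {F A : Type*} [Field F] [AddCommGroup A] [Module F A]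
    (x : Module.Basis (Fin 5) F A) (T : List (ℕ × ℕ × ℕ × A))
    (S : List (ℕ × ℕ × ℕ × Module.Dual F A))
    (ΔX ΔY : Fin 5 → TensorCube F (A × Module.Dual F A)) : ExplicitData F A where
  bracket := tableOperation x (T.map fun r => (lab r.1, lab r.2.1, lab r.2.2.1, r.2.2.2))
  psi := tableOperation (x.prod x.dualBasis)
    ((T.map fun r =>
        (Sum.inl (lab r.1), Sum.inl (lab r.2.1), Sum.inl (lab r.2.2.1), (r.2.2.2, 0))) ++
      (S.map fun r =>
        (Sum.inl (lab r.1), Sum.inl (lab r.2.1), Sum.inr (lab r.2.2.1), (0, r.2.2.2))))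
  coproduct := (x.prod x.dualBasis).constr F (Sum.elim ΔX ΔY)

/-- `x_n` as an element of `A`. -/
noncomputable def vec {F A : Type*} [Field F] [AddCommGroup A] [Module F A]
    (x : Module.Basis (Fin 5) F A) (n : ℕ) : A := x (lab n)

/-- `x_n*` as an element of `A*`. -/
noncomputable def covec {F A : Type*} [Field F] [AddCommGroup A] [Module F A]
    (x : Module.Basis (Fin 5) F A) (n : ℕ) : Module.Dual F A := x.dualBasis (lab n)

/-- `x_n` as an element of `A × A*`. -/
noncomputable def gen {F A : Type*} [Field F] [AddCommGroup A] [Module F A]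
    (x : Module.Basis (Fin 5) F A) (n : ℕ) : A × Module.Dual F A := (vec x n, 0)

/-- `x_n*` as an element of `A × A*`. -/
noncomputable def cogen {F A : Type*} [Field F] [AddCommGroup A] [Module F A]
    (x : Module.Basis (Fin 5) F A) (n : ℕ) : A × Module.Dual F A := (0, covec x n)

/-! In the tables below `a n`, `d n` are `x_n` in `A` and `x_n*` in `A*`, and `X n`, `Y n` are the same vectors
in `A × A*`. -/

noncomputable def data1 {F A : Type*} [Field F] [AddCommGroup A] [Module F A]
    (x : Module.Basis (Fin 5) F A) : ExplicitData F A :=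
  let a := vec x
  let d := covec x
  let X := gen x
  let Y := cogen x
  let w := wedge F (L := A × Module.Dual F A)
  ofTables x
    [(2, 3, 4, a 1)]
    [(2, 3, 1, -d 4), (3, 4, 1, -d 2), (2, 4, 1, d 3)]
    ![0,
      w (X 1) (Y 3) (Y 4),
      w (X 1) (Y 4) (Y 2),
      w (X 1) (Y 2) (Y 3),
      0]
    ![w (Y 2) (Y 4) (Y 3),
      0,
      0,
      0,
      0]

noncomputable def data2 {F A : Type*} [Field F] [AddCommGroup A] [Module F A]
    (x : Module.Basis (Fin 5) F A) : ExplicitData F A :=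
  let a := vec x
  let d := covec x
  let X := gen x
  let Y := cogen x
  let w := wedge F (L := A × Module.Dual F A)
  ofTables x
    [(2, 3, 4, a 1), (3, 4, 5, a 2)]
    [(2, 3, 1, -d 4), (2, 4, 1, d 3), (3, 4, 1, -d 2), (3, 4, 2, -d 5), (4, 5, 2, -d 3),
      (3, 5, 2, d 4)]
    ![0,
      w (X 1) (Y 3) (Y 4),
      w (X 1) (Y 4) (Y 2) + w (X 2) (Y 4) (Y 5),
      w (X 1) (Y 2) (Y 3) + w (Y 5) (Y 3) (X 2),
      w (X 2) (Y 3) (Y 4)]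
    ![w (Y 2) (Y 4) (Y 3),
      w (Y 3) (Y 5) (Y 4),
      0,
      0,
      0]

noncomputable def data3 {F A : Type*} [Field F] [AddCommGroup A] [Module F A]
    (x : Module.Basis (Fin 5) F A) : ExplicitData F A :=
  let a := vec x
  let d := covec x
  let X := gen x
  let Y := cogen x
  let w := wedge F (L := A × Module.Dual F A)
  ofTables x
    [(2, 3, 4, a 1), (2, 4, 5, a 2), (1, 4, 5, a 1)]
    [(2, 3, 1, -d 4), (2, 4, 1, d 3), (3, 4, 1, -d 2), (2, 4, 2, -d 5), (2, 5, 2, d 4),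
      (4, 5, 2, -d 2), (1, 4, 1, -d 5), (4, 5, 1, -d 1), (1, 5, 1, d 4)]
    ![w (X 1) (Y 4) (Y 5),
      w (X 1) (Y 3) (Y 4) + w (X 2) (Y 4) (Y 5),
      w (X 1) (Y 4) (Y 2),
      w (X 1) (Y 2) (Y 3) + w (X 2) (Y 5) (Y 2) + w (Y 5) (Y 1) (X 1),
      w (Y 2) (Y 4) (X 2) + w (Y 1) (Y 4) (X 1)]
    ![w (Y 1) (Y 5) (Y 4) + w (Y 2) (Y 4) (Y 3),
      w (Y 2) (Y 5) (Y 4),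
      0,
      0,
      0]

noncomputable def data4 {F A : Type*} [Field F] [AddCommGroup A] [Module F A]
    (x : Module.Basis (Fin 5) F A) (α : F) : ExplicitData F A :=
  let a := vec x
  let d := covec x
  let X := gen x
  let Y := cogen x
  let w := wedge F (L := A × Module.Dual F A)
  ofTables x
    [(2, 3, 4, α • a 1 + a 2), (1, 3, 4, a 2), (2, 4, 5, a 2), (1, 4, 5, a 1)]
    [(2, 3, 1, -(α • d 4)), (2, 4, 1, α • d 3), (3, 4, 1, -(α • d 2)), (2, 3, 2, -d 4),
      (2, 4, 2, d 3), (3, 4, 2, -d 2), (1, 3, 2, -d 4), (1, 4, 2, d 3), (3, 4, 2, -d 1),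
      (2, 4, 2, -d 5), (4, 5, 2, -d 2), (2, 5, 2, d 4), (1, 4, 1, -d 5), (4, 5, 1, -d 1),
      (1, 5, 1, d 4)]
    ![w (X 2) (Y 3) (Y 4) + w (X 1) (Y 4) (Y 5),
      α • w (X 1) (Y 3) (Y 4) + w (X 2) (Y 3) (Y 4) + w (X 2) (Y 4) (Y 5),
      α • w (X 1) (Y 4) (Y 2) + w (X 2) (Y 4) (Y 2) + w (X 2) (Y 4) (Y 1),
      α • w (X 1) (Y 2) (Y 3) + w (X 2) (Y 2) (Y 3) + w (Y 1) (Y 3) (X 2)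
        + w (Y 5) (Y 2) (X 2) + w (Y 5) (Y 1) (X 1),
      w (Y 2) (Y 4) (X 2) + w (Y 1) (Y 4) (X 1)]
    ![w (Y 1) (Y 5) (Y 4) + α • w (Y 2) (Y 4) (Y 3),
      w (Y 2) (Y 4) (Y 3) + w (Y 1) (Y 4) (Y 3) + w (Y 2) (Y 5) (Y 4),
      0,
      0,
      0]

noncomputable def data5 {F A : Type*} [Field F] [AddCommGroup A] [Module F A]
    (x : Module.Basis (Fin 5) F A) (α : F) : ExplicitData F A :=
  let a := vec x
  let d := covec x
  let X := gen x
  let Y := cogen x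
  let w := wedge F (L := A × Module.Dual F A)
  ofTables x
    [(2, 3, 4, α • a 1 + a 2), (1, 3, 4, a 2)]
    [(2, 3, 1, -(α • d 4)), (3, 4, 1, -(α • d 2)), (2, 4, 1, α • d 3), (2, 3, 2, -d 4),
      (2, 4, 2, d 3), (3, 4, 2, -d 2 - d 1), (1, 3, 2, -d 4), (1, 4, 2, d 3)]
    ![w (X 2) (Y 3) (Y 4),
      α • w (X 1) (Y 3) (Y 4) + w (X 2) (Y 3) (Y 4),
      w (Y 1) (X 2) (Y 4) + w (X 2) (Y 4) (Y 2) + α • w (X 1) (Y 4) (Y 2),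
      w (Y 1) (Y 3) (X 2) + α • w (X 1) (Y 2) (Y 3) + w (X 2) (Y 2) (Y 3),
      0]
    ![α • w (Y 2) (Y 4) (Y 3),
      w (Y 1) (Y 4) (Y 3) + w (Y 2) (Y 4) (Y 3),
      0,
      0,
      0]

noncomputable def data6 {F A : Type*} [Field F] [AddCommGroup A] [Module F A]
    (x : Module.Basis (Fin 5) F A) : ExplicitData F A :=
  let a := vec x
  let d := covec x
  let X := gen x
  let Y := cogen x
  let w := wedge F (L := A × Module.Dual F A)
  ofTables x
    [(2, 3, 4, a 1), (1, 3, 4, a 2), (2, 4, 5, a 2), (1, 4, 5, a 1)]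
    [(2, 3, 1, -d 4), (2, 4, 1, d 3), (3, 4, 1, -d 2), (1, 3, 2, -d 4), (3, 4, 2, -d 1),
      (1, 4, 2, d 3), (2, 4, 2, -d 5), (4, 5, 2, -d 2), (2, 5, 2, d 4), (1, 4, 1, -d 5),
      (4, 5, 1, -d 1), (1, 5, 1, d 4)]
    ![w (X 1) (Y 4) (Y 5) + w (X 2) (Y 3) (Y 4),
      w (X 1) (Y 3) (Y 4) + w (X 2) (Y 4) (Y 5),
      w (X 1) (Y 4) (Y 2) + w (X 2) (Y 4) (Y 1),
      w (X 1) (Y 2) (Y 3) + w (X 2) (Y 1) (Y 3) + w (Y 5) (Y 2) (X 2) + w (Y 5) (Y 1) (X 1),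
      w (Y 2) (Y 4) (X 2) + w (Y 1) (Y 4) (X 1)]
    ![w (Y 2) (Y 4) (Y 3) + w (Y 1) (Y 5) (Y 4),
      w (Y 1) (Y 4) (Y 3) + w (Y 2) (Y 5) (Y 4),
      0,
      0,
      0]

noncomputable def data7 {F A : Type*} [Field F] [AddCommGroup A] [Module F A]
    (x : Module.Basis (Fin 5) F A) : ExplicitData F A :=
  let a := vec x
  let d := covec x
  let X := gen x
  let Y := cogen x
  let w := wedge F (L := A × Module.Dual F A)
  ofTables x
    [(2, 3, 4, a 1), (2, 4, 5, -a 2), (3, 4, 5, a 3)]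
    [(2, 3, 1, -d 4), (2, 4, 1, d 3), (3, 4, 1, -d 2), (2, 4, 2, d 5), (4, 5, 2, d 2),
      (2, 5, 2, -d 4), (3, 4, 3, -d 5), (4, 5, 3, -d 3), (3, 5, 3, d 4)]
    ![0,
      w (X 1) (Y 3) (Y 4) - w (X 2) (Y 4) (Y 5),
      w (X 1) (Y 4) (Y 2) + w (X 3) (Y 4) (Y 5),
      w (X 1) (Y 2) (Y 3) - w (X 2) (Y 5) (Y 2) + w (X 3) (Y 5) (Y 3),
      -w (X 2) (Y 2) (Y 4) + w (X 3) (Y 3) (Y 4)]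
    ![w (Y 2) (Y 4) (Y 3),
      -w (Y 2) (Y 5) (Y 4),
      w (Y 3) (Y 5) (Y 4),
      0,
      0]

noncomputable def data8 {F A : Type*} [Field F] [AddCommGroup A] [Module F A]
    (x : Module.Basis (Fin 5) F A) : ExplicitData F A :=
  let a := vec x
  let d := covec x
  let X := gen x
  let Y := cogen x
  let w := wedge F (L := A × Module.Dual F A)
  ofTables x
    [(2, 3, 4, a 2), (1, 3, 4, a 1)]
    [(1, 3, 1, -d 4), (1, 4, 1, d 3), (3, 4, 1, -d 1), (2, 3, 2, -d 4), (2, 4, 2, d 3),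
      (3, 4, 2, -d 2)]
    ![w (X 1) (Y 3) (Y 4),
      w (X 2) (Y 3) (Y 4),
      w (X 1) (Y 4) (Y 1) + w (X 2) (Y 4) (Y 2),
      w (X 1) (Y 1) (Y 3) + w (X 2) (Y 2) (Y 3),
      0]
    ![w (Y 1) (Y 4) (Y 3),
      w (Y 2) (Y 4) (Y 3),
      0,
      0,
      0]

noncomputable def data9 {F A : Type*} [Field F] [AddCommGroup A] [Module F A]
    (x : Module.Basis (Fin 5) F A) (α : F) : ExplicitData F A :=
  let a := vec x
  let d := covec x
  let X := gen x
  let Y := cogen x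
  let w := wedge F (L := A × Module.Dual F A)
  ofTables x
    [(2, 3, 4, a 1), (3, 4, 5, a 3 + α • a 2), (2, 4, 5, a 3), (1, 4, 5, a 1)]
    [(2, 3, 1, -d 4), (2, 4, 1, d 3), (3, 4, 1, -d 2), (3, 4, 3, -d 5), (4, 5, 3, -d 3),
      (3, 5, 3, d 4), (3, 4, 2, -(α • d 5)), (4, 5, 2, -(α • d 3)), (3, 5, 2, α • d 4),
      (2, 4, 3, -d 5), (4, 5, 3, -d 2), (2, 5, 3, d 4), (1, 4, 1, -d 5), (4, 5, 1, -d 1),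
      (1, 5, 1, d 4)]
    ![w (X 1) (Y 4) (Y 5),
      w (X 1) (Y 3) (Y 4) + w (X 3) (Y 4) (Y 5),
      w (X 1) (Y 4) (Y 2) + α • w (X 2) (Y 4) (Y 5) + w (X 3) (Y 4) (Y 5),
      w (X 1) (Y 2) (Y 3) + w (X 3) (Y 5) (Y 3) + α • w (X 2) (Y 5) (Y 3)
        + w (X 3) (Y 5) (Y 2) + w (X 1) (Y 5) (Y 1),
      w (Y 3) (Y 4) (X 3) + α • w (Y 3) (Y 4) (X 2) + w (Y 2) (Y 4) (X 3) + w (Y 1) (Y 4) (X 1)]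
    ![w (Y 3) (Y 2) (Y 4) + w (Y 4) (Y 1) (Y 5),
      α • w (Y 4) (Y 3) (Y 5),
      w (Y 4) (Y 3) (Y 5) + w (Y 4) (Y 2) (Y 5),
      0,
      0]

noncomputable def data10 {F A : Type*} [Field F] [AddCommGroup A] [Module F A]
    (x : Module.Basis (Fin 5) F A) : ExplicitData F A :=
  let a := vec x
  let d := covec x
  let X := gen x
  let Y := cogen x
  let w := wedge F (L := A × Module.Dual F A)
  ofTables x
    [(2, 3, 4, a 1), (3, 4, 5, a 3), (2, 4, 5, a 2), (1, 4, 5, (2 : F) • a 1)]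
    [(2, 3, 1, -d 4), (3, 4, 1, -d 2), (2, 4, 1, d 3), (3, 4, 3, -d 5), (4, 5, 3, -d 3),
      (3, 5, 3, d 4), (2, 4, 2, -d 5), (4, 5, 2, -d 2), (2, 5, 2, d 4),
      (1, 4, 1, -((2 : F) • d 5)), (4, 5, 1, -((2 : F) • d 1)), (1, 5, 1, (2 : F) • d 4)]
    ![(2 : F) • w (X 1) (Y 4) (Y 5),
      w (X 1) (Y 3) (Y 4) + w (X 2) (Y 4) (Y 5),
      w (X 1) (Y 4) (Y 2) + w (X 3) (Y 4) (Y 5),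
      w (X 1) (Y 2) (Y 3) + w (X 3) (Y 5) (Y 3) + w (X 2) (Y 5) (Y 2)
        + (2 : F) • w (X 1) (Y 5) (Y 1),
      w (X 3) (Y 3) (Y 4) + w (X 2) (Y 2) (Y 4) + (2 : F) • w (X 1) (Y 1) (Y 4)]
    ![w (Y 3) (Y 2) (Y 4) + (2 : F) • w (Y 4) (Y 1) (Y 5),
      w (Y 4) (Y 2) (Y 5),
      w (Y 4) (Y 3) (Y 5),
      0,
      0]

noncomputable def data11 {F A : Type*} [Field F] [AddCommGroup A] [Module F A]
    (x : Module.Basis (Fin 5) F A) : ExplicitData F A :=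
  let a := vec x
  let d := covec x
  let X := gen x
  let Y := cogen x
  let w := wedge F (L := A × Module.Dual F A)
  ofTables x
    [(2, 3, 4, a 1), (1, 3, 4, a 2), (1, 2, 4, a 3)]
    [(2, 3, 1, -d 4), (3, 4, 1, -d 2), (2, 4, 1, d 3), (1, 3, 2, -d 4), (3, 4, 2, -d 1),
      (1, 4, 2, d 3), (1, 4, 3, d 2), (1, 2, 3, -d 4), (2, 4, 3, -d 1)]
    ![w (X 2) (Y 3) (Y 4) + w (X 3) (Y 2) (Y 4),
      w (X 1) (Y 3) (Y 4) + w (X 3) (Y 4) (Y 1),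
      w (X 1) (Y 4) (Y 2) + w (X 2) (Y 4) (Y 1),
      w (X 1) (Y 2) (Y 3) + w (X 2) (Y 1) (Y 3) + w (X 3) (Y 1) (Y 2),
      0]
    ![w (Y 3) (Y 2) (Y 4),
      w (Y 3) (Y 1) (Y 4),
      w (Y 2) (Y 1) (Y 4),
      0,
      0]

noncomputable def data12 {F A : Type*} [Field F] [AddCommGroup A] [Module F A]
    (x : Module.Basis (Fin 5) F A) (β : F) : ExplicitData F A :=
  let a := vec x
  let d := covec x
  let X := gen x
  let Y := cogen x
  let w := wedge F (L := A × Module.Dual F A)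
  ofTables x
    [(1, 4, 5, a 1), (2, 4, 5, a 3), (3, 4, 5, β • a 2 + (1 + β) • a 3)]
    [(1, 4, 1, -d 5), (4, 5, 1, -d 1), (1, 5, 1, d 4), (2, 4, 3, -d 5), (4, 5, 3, -d 2),
      (2, 5, 3, d 4), (3, 4, 2, -(β • d 5)), (4, 5, 2, -(β • d 3)), (3, 5, 2, β • d 4),
      (3, 4, 3, -((1 + β) • d 5)), (4, 5, 3, -((1 + β) • d 3)), (3, 5, 3, (1 + β) • d 4)]
    ![w (X 1) (Y 4) (Y 5),
      w (X 3) (Y 4) (Y 5),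
      β • w (X 2) (Y 4) (Y 5) + (1 + β) • w (X 3) (Y 4) (Y 5),
      w (X 1) (Y 5) (Y 1) + w (X 3) (Y 5) (Y 2) + β • w (X 2) (Y 5) (Y 3) + (1
        + β) • w (X 3) (Y 5) (Y 3),
      w (X 1) (Y 1) (Y 4) + w (X 3) (Y 2) (Y 4) + β • w (X 2) (Y 3) (Y 4) + (1
        + β) • w (X 3) (Y 3) (Y 4)]
    ![w (Y 4) (Y 1) (Y 5),
      β • w (Y 4) (Y 3) (Y 5),
      w (Y 4) (Y 2) (Y 5) + (1 + β) • w (Y 4) (Y 3) (Y 5),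
      0,
      0]

noncomputable def data13 {F A : Type*} [Field F] [AddCommGroup A] [Module F A]
    (x : Module.Basis (Fin 5) F A) : ExplicitData F A :=
  let a := vec x
  let d := covec x
  let X := gen x
  let Y := cogen x
  let w := wedge F (L := A × Module.Dual F A)
  ofTables x
    [(1, 4, 5, a 1), (2, 4, 5, a 2), (3, 4, 5, a 3)]
    [(1, 4, 1, -d 5), (4, 5, 1, -d 1), (1, 5, 1, d 4), (2, 4, 2, -d 5), (4, 5, 2, -d 2),
      (2, 5, 2, d 4), (3, 4, 3, -d 5), (4, 5, 3, -d 3), (3, 5, 3, d 4)]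
    ![w (X 1) (Y 4) (Y 5),
      w (X 2) (Y 4) (Y 5),
      w (X 3) (Y 4) (Y 5),
      w (Y 5) (Y 1) (X 1) + w (Y 5) (Y 2) (X 2) + w (Y 5) (Y 3) (X 3),
      w (Y 1) (Y 4) (X 1) + w (Y 2) (Y 4) (X 2) + w (Y 3) (Y 4) (X 3)]
    ![w (Y 4) (Y 1) (Y 5),
      w (Y 4) (Y 2) (Y 5),
      w (Y 4) (Y 3) (Y 5),
      0,
      0]

noncomputable def data14 {F A : Type*} [Field F] [AddCommGroup A] [Module F A]
    (x : Module.Basis (Fin 5) F A) (s t u : F) : ExplicitData F A :=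
  let a := vec x
  let d := covec x
  let X := gen x
  let Y := cogen x
  let w := wedge F (L := A × Module.Dual F A)
  ofTables x
    [(1, 4, 5, a 2), (2, 4, 5, a 3), (3, 4, 5, s • a 1 + t • a 2 + u • a 3)]
    [(1, 4, 2, -d 5), (4, 5, 2, -d 1), (1, 5, 2, d 4), (2, 4, 3, -d 5), (4, 5, 3, -d 2),
      (2, 5, 3, d 4), (3, 4, 1, -(s • d 5)), (4, 5, 1, -(s • d 3)), (3, 5, 1, s • d 4),
      (3, 4, 2, -(t • d 5)), (4, 5, 2, -(t • d 3)), (3, 5, 2, t • d 4), (3, 4, 3, -(u • d 5)),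
      (4, 5, 3, -(u • d 3)), (3, 5, 3, u • d 4)]
    ![w (X 2) (Y 4) (Y 5),
      w (X 3) (Y 4) (Y 5),
      s • w (X 1) (Y 4) (Y 5) + t • w (X 2) (Y 4) (Y 5) + u • w (X 3) (Y 4) (Y 5),
      w (X 2) (Y 5) (Y 1) + w (X 3) (Y 5) (Y 2) + s • w (X 1) (Y 5) (Y 3)
        + t • w (X 2) (Y 5) (Y 3) + u • w (X 3) (Y 5) (Y 3),
      w (X 2) (Y 1) (Y 4) + w (X 3) (Y 2) (Y 4) + s • w (X 1) (Y 3) (Y 4)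
        + t • w (X 2) (Y 3) (Y 4) + u • w (X 3) (Y 3) (Y 4)]
    ![s • w (Y 4) (Y 3) (Y 5),
      w (Y 4) (Y 1) (Y 5) + t • w (Y 4) (Y 3) (Y 5),
      w (Y 4) (Y 2) (Y 5) + u • w (Y 4) (Y 3) (Y 5),
      0,
      0]

noncomputable def data15 {F A : Type*} [Field F] [AddCommGroup A] [Module F A]
    (x : Module.Basis (Fin 5) F A) : ExplicitData F A :=
  let a := vec x
  let d := covec x
  let X := gen x
  let Y := cogen x
  let w := wedge F (L := A × Module.Dual F A)
  ofTables x
    [(2, 3, 4, a 1), (1, 3, 4, a 2)]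
    [(2, 3, 1, -d 4), (3, 4, 1, -d 2), (2, 4, 1, d 3), (1, 3, 2, -d 4), (3, 4, 2, -d 1),
      (1, 4, 2, d 3)]
    ![w (X 2) (Y 3) (Y 4),
      w (X 1) (Y 3) (Y 4),
      w (X 1) (Y 4) (Y 2) + w (Y 1) (X 2) (Y 4),
      w (X 1) (Y 2) (Y 3) + w (Y 1) (Y 3) (X 2),
      0]
    ![w (Y 2) (Y 4) (Y 3),
      w (Y 1) (Y 4) (Y 3),
      0,
      0,
      0]

noncomputable def data16 {F A : Type*} [Field F] [AddCommGroup A] [Module F A]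
    (x : Module.Basis (Fin 5) F A) : ExplicitData F A :=
  let a := vec x
  let d := covec x
  let X := gen x
  let Y := cogen x
  let w := wedge F (L := A × Module.Dual F A)
  ofTables x
    [(2, 3, 4, -a 2), (1, 3, 4, a 1), (1, 2, 3, a 3), (1, 2, 4, -a 4)]
    [(2, 3, 2, d 4), (3, 4, 2, d 2), (2, 4, 2, -d 3), (1, 3, 1, -d 4), (3, 4, 1, -d 1),
      (1, 4, 1, d 3), (1, 2, 3, -d 3), (1, 3, 3, d 2), (2, 3, 3, -d 1), (1, 2, 4, d 4),
      (1, 4, 4, -d 2), (2, 4, 4, d 1)]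
    ![w (X 1) (Y 3) (Y 4) + w (Y 2) (Y 3) (X 3) + w (Y 4) (Y 2) (X 4),
      w (X 3) (Y 3) (Y 1) + w (Y 4) (Y 3) (X 2) + w (X 4) (Y 1) (Y 4),
      w (Y 1) (Y 2) (X 3) + w (Y 2) (Y 4) (X 2) + w (Y 4) (Y 1) (X 1),
      w (Y 1) (X 4) (Y 2) + w (X 1) (Y 1) (Y 3) + w (X 2) (Y 3) (Y 2),
      0]
    ![w (Y 1) (Y 4) (Y 3),
      w (Y 2) (Y 3) (Y 4),
      w (Y 1) (Y 3) (Y 2),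
      w (Y 1) (Y 2) (Y 4),
      0]

noncomputable def data17 {F A : Type*} [Field F] [AddCommGroup A] [Module F A]
    (x : Module.Basis (Fin 5) F A) : ExplicitData F A :=
  let a := vec x
  let d := covec x
  let X := gen x
  let Y := cogen x
  let w := wedge F (L := A × Module.Dual F A)
  ofTables x
    [(1, 2, 3, a 1)]
    [(1, 2, 1, -d 3), (2, 3, 1, -d 1), (1, 3, 1, d 2)]
    ![w (X 1) (Y 2) (Y 3),
      w (Y 3) (Y 1) (X 1),
      w (Y 1) (Y 2) (X 1),
      0,
      0]
    ![w (Y 1) (Y 3) (Y 2),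
      0,
      0,
      0,
      0]

/-- The seventeen families, in order; `family x α β s t u j` is the `(j + 1)`-st one. -/
noncomputable def family {F A : Type*} [Field F] [AddCommGroup A] [Module F A]
    (x : Module.Basis (Fin 5) F A) (α β s t u : F) : Fin 17 → ExplicitData F A :=
  ![data1 x, data2 x, data3 x, data4 x α, data5 x α, data6 x, data7 x, data8 x, data9 x α,
    data10 x, data11 x, data12 x β, data13 x, data14 x s t u, data15 x, data16 x, data17 x]

/-! The symmetric form `⟨(a, f), (a', f')⟩ = f a' + f' a` on `A × A*` is nondegenerate, and it is
invariant: each map `μ(·, p, q)` is skew for it, where `μ` is the semi-direct bracket. It identifies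
`(A × A*)*` with `A × A*` through `dualToDouble`. The involutive derivation `D` of `A` extends to
the map `D̃ = doubleMap D`, which is skew for the form and is again an involutive derivation, now of
`μ`.

Let `p, q, r` represent the functionals `ξ, η, ζ`. The definition of `Δ₁` amounts to `⟨ξ ⊗ η ⊗ ζ, Δ₁
v⟩ = ξ (μ(v, D̃r, D̃q))`; the maps `Δ₂` and `Δ₃` give the cyclic permutations. By invariance the
three terms add up to the pairing of `v` with `μ(p, D̃q, D̃r) + μ(D̃p, q, D̃r) + μ(D̃p, D̃q, r)`.
Expanding `D̃² μ(p, q, r) = μ(p, q, r)` by the Leibniz rule shows that this sum is `-μ(p, q, r)`. So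
`Δ*` is `-μ` up to the identification (`dualToDouble_dualOperation`). The Filippov identity is
homogeneous of degree two in the bracket, so `-μ` is a 3-Lie bracket whenever `μ` is one. The
cocycle conditions hold for any endomorphism `D`, because `v ↦ μ(v, p, q)` is a 1-cocycle for the
adjoint action.

That `μ` is a 3-Lie bracket needs one identity beyond the derivation property of `ad`, namely
`bracket_bracket`, which follows from the Filippov identity after division by 3.

The result `-μ` no longer contains `D`. It therefore suffices to find one involutive derivation for
each family, here a diagonal matrix of signs, and to compare the listed coproduct with `-μ`. This
comparison, the Filippov identity of the seventeen brackets and the tables of `ψ` are polynomial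
identities in coordinates. -/

/-! ### Identities in 3-Lie algebras and the semi-direct product -/

namespace IsThreeLieBracket

variable {F L : Type*} [Field F] [AddCommGroup L] [Module F L] {b : TernaryOp F L}

theorem swap_left (h : IsThreeLieBracket b) (x y z : L) : b x y z = -b y x z := by
  have := h.alt_left (x + y) z
  simp only [map_add, LinearMap.add_apply, h.alt_left, zero_add, add_zero] at this
  exact eq_neg_of_add_eq_zero_right this

theorem swap_right (h : IsThreeLieBracket b) (x y z : L) : b x y z = -b x z y := by
  have := h.alt_right x (y + z)
  simp only [map_add, LinearMap.add_apply, h.alt_right, zero_add, add_zero] at this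
  exact eq_neg_of_add_eq_zero_right this

theorem rotate (h : IsThreeLieBracket b) (x y z : L) : b x y z = b y z x := by
  rw [h.swap_left x y z, h.swap_right y x z, neg_neg]

/-- This lemma and the next two apply the Filippov identity to the derivations `ad(a, x)`, `ad(z,
c)` and `ad(a, c)`. The arguments are arranged so that the three results can be permuted cyclically
in `x, y, z` and added in `bracket_bracket`. -/
theorem bracket_nested_right (h : IsThreeLieBracket b) (a c x y z : L) :
    b a x (b y z c) = b (b a x y) z c + b (b a z x) y c + b y z (b a x c) := by
  rw [h.filippov a x y z c, h.swap_left y (b a x z) c, h.swap_right a x z]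
  simp only [map_neg, LinearMap.neg_apply, neg_neg]

theorem bracket_nested_left (h : IsThreeLieBracket b) (a c x y z : L) :
    b (b a x y) z c = b x y (b a z c) + b a y (b z x c) + b a x (b y z c) := by
  rw [h.rotate (b a x y) z c, h.filippov z c a x y, h.rotate (b z c a) x y, ← h.rotate a z c,
    h.swap_right a (b z c x) y, ← h.rotate x z c, h.swap_left x z c, ← h.rotate y z c]
  simp only [map_neg, neg_neg]

theorem bracket_nested_middle (h : IsThreeLieBracket b) (a c x y z : L) :
    b a (b x y z) c = b y z (b a x c) + b z x (b a y c) + b x y (b a z c) := by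
  rw [h.swap_right a, h.filippov a c x y z, h.rotate (b a c x) y z, h.rotate x (b a c y) z,
    h.rotate (b a c y) z x, h.swap_right a c x, h.swap_right a c y, h.swap_right a c z]
  simp only [map_neg, neg_add, neg_neg]

/-- The identity which makes the coadjoint action a representation. -/
theorem bracket_bracket [CharZero F] (h : IsThreeLieBracket b) (a c x y z : L) :
    b a (b x y z) c = -(b a x (b y z c) + b a y (b z x c) + b a z (b x y c)) := by
  have e1 := h.bracket_nested_right a c x y z
  have e2 := h.bracket_nested_right a c y z x
  have e3 := h.bracket_nested_right a c z x y
  have f1 := h.bracket_nested_left a c x y z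
  have f2 := h.bracket_nested_left a c y z x
  have f3 := h.bracket_nested_left a c z x y
  rw [h.bracket_nested_middle a c x y z]
  generalize b a x (b y z c) = T1 at *
  generalize b a y (b z x c) = T2 at *
  generalize b a z (b x y c) = T3 at *
  generalize b y z (b a x c) = V1 at *
  generalize b z x (b a y c) = V2 at *
  generalize b x y (b a z c) = V3 at *
  rw [← sub_eq_zero]
  have h3 : (3 : F) ≠ 0 := by norm_num
  refine (smul_eq_zero.1 (?_ : (3 : F) • (_ : L) = 0)).resolve_left h3
  -- Let `T` and `V` be the sums of the `Tᵢ` and of the `Vᵢ`, and `W` the cyclic sum of `b (b a x y)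
  -- z c`. The first three relations add up to `T = 2W + V`, the last three to `W = V + 2T`.
  -- Eliminating `W` gives `3(T + V) = 0`, while the left side of the claim has become `V`.
  linear_combination (norm := module) (-1 : F) • (e1 + e2 + e3) - (2 : F) • (f1 + f2 + f3)

/-- The sign of a 3-Lie bracket may be changed. -/
theorem neg_of_injective {L' : Type*} [AddCommGroup L'] [Module F L'] {b' : TernaryOp F L'}
    (h : IsThreeLieBracket b) (J : L' →ₗ[F] L) (hJ : Function.Injective J)
    (hb : ∀ x y z, J (b' x y z) = -b (J x) (J y) (J z)) : IsThreeLieBracket b' where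
  alt_left x y := hJ (by simp [hb, h.alt_left])
  alt_right x y := hJ (by simp [hb, h.alt_right])
  alt_outer x y := hJ (by simp [hb, h.alt_outer])
  filippov x₁ x₂ x₃ x₄ x₅ := hJ (by simp [hb, h.filippov (J x₁) (J x₂)])

/-- After a rotation this says that `ad(p, q)` is a derivation; it is the cocycle condition for `v ↦
b v p q`. -/
theorem isOneCocycle_of_ad (h : IsThreeLieBracket b) (p q x y z : L) :
    b (b x y z) p q = b x y (b z p q) + b y z (b x p q) + b z x (b y p q) := by
  rw [h.rotate, h.filippov, h.rotate (b p q x), h.rotate x (b p q y) z, h.rotate (b p q y) z x,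
    ← h.rotate x p q, ← h.rotate y p q, ← h.rotate z p q]
  abel

/-- The coadjoint representation turns `A × A*` into a 3-Lie algebra. -/
theorem semidirect [CharZero F] (h : IsThreeLieBracket b) :
    IsThreeLieBracket (semidirectBracket b) where
  alt_left p q := by
    refine Prod.ext (by simp [semidirectBracket_apply, h.alt_left]) (LinearMap.ext fun c => ?_)
    simp only [semidirectBracket_apply, LinearMap.add_apply, coad_apply, h.alt_left, map_zero,
      h.swap_left q.1 p.1 c, map_neg, Prod.snd_zero, LinearMap.zero_apply]
    ring
  alt_right p q := by
    refine Prod.ext (by simp [semidirectBracket_apply, h.alt_right]) (LinearMap.ext fun c => ?_)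
    simp only [semidirectBracket_apply, LinearMap.add_apply, coad_apply, h.alt_left, map_zero,
      h.swap_left q.1 p.1 c, map_neg, Prod.snd_zero, LinearMap.zero_apply]
    ring
  alt_outer p q := by
    refine Prod.ext (by simp [semidirectBracket_apply, h.alt_outer]) (LinearMap.ext fun c => ?_)
    simp only [semidirectBracket_apply, LinearMap.add_apply, coad_apply, h.alt_left, map_zero,
      h.swap_left q.1 p.1 c, map_neg, Prod.snd_zero, LinearMap.zero_apply]
    ring
  filippov p₁ p₂ p₃ p₄ p₅ := by
    obtain ⟨a₁, f₁⟩ := p₁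
    obtain ⟨a₂, f₂⟩ := p₂
    obtain ⟨a₃, f₃⟩ := p₃
    obtain ⟨a₄, f₄⟩ := p₄
    obtain ⟨a₅, f₅⟩ := p₅
    refine Prod.ext (h.filippov _ _ _ _ _) (LinearMap.ext fun c => ?_)
    simp only [semidirectBracket_apply, LinearMap.add_apply, coad_apply, Prod.snd_add]
    -- The functionals `f₃, f₄, f₅` sit inside the inner bracket or are acted on by it, and for them
    -- the Filippov identity suffices. For `f₁` and `f₂` the inner bracket `b a₃ a₄ a₅` is an
    -- argument of the coadjoint action, which calls for `bracket_bracket`.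
    have e5 := congrArg f₅ (h.filippov a₁ a₂ a₃ a₄ c)
    have e4 := congrArg f₄ (h.filippov a₁ a₂ a₅ a₃ c)
    have e3 := congrArg f₃ (h.filippov a₁ a₂ a₄ a₅ c)
    have e2 := congrArg f₂ (h.bracket_bracket a₁ c a₃ a₄ a₅)
    have e1 := congrArg f₁ (h.bracket_bracket a₂ c a₃ a₄ a₅)
    rw [h.swap_left (b a₃ a₄ a₅) a₁ c, h.swap_left a₃ a₁, h.swap_left a₄ a₁, h.swap_left a₅ a₁]
    simp only [map_add, map_neg] at e1 e2 e3 e4 e5 ⊢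
    linear_combination e2 - e1 - e3 - e4 - e5

end IsThreeLieBracket

/-! ### The invariant form on the double and the extension of derivations -/

section Double

variable {F A ι : Type*} [Field F] [AddCommGroup A] [Module F A]

/-- The identification `(A × A*)* ≃ A × A*` given by the canonical symmetric bilinear form. -/
noncomputable def dualToDouble [Fintype ι] [DecidableEq ι] (x : Module.Basis ι F A) :
    Module.Dual F (A × Module.Dual F A) →ₗ[F] A × Module.Dual F A :=
  LinearMap.prod
    (∑ i, (Module.Dual.eval F (A × Module.Dual F A) (0, x.dualBasis i)).smulRight (x i))
    (LinearMap.inl F A (Module.Dual F A)).dualMap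

theorem dualToDouble_apply [Fintype ι] [DecidableEq ι] (x : Module.Basis ι F A)
    (ζ : Module.Dual F (A × Module.Dual F A)) :
    dualToDouble x ζ = (∑ i, ζ (0, x.dualBasis i) • x i, ζ ∘ₗ LinearMap.inl F A _) := by
  refine Prod.ext ?_ rfl
  simp [dualToDouble]

/-- `dualToDouble x ζ` is the vector that represents `ζ` through the canonical form. The proof
expands the `A*`-part of `v` in the dual basis. -/
theorem dualToDouble_pairing [Fintype ι] [DecidableEq ι] (x : Module.Basis ι F A)
    (ζ : Module.Dual F (A × Module.Dual F A)) (v : A × Module.Dual F A) :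
    ζ v = (dualToDouble x ζ).2 v.1 + v.2 (dualToDouble x ζ).1 := by
  have h : v.2 = ∑ i, v.2 (x i) • x.dualBasis i := by
    refine x.ext fun j => ?_
    simp
  have h2 : v = (v.1, 0) + ∑ i, v.2 (x i) • ((0 : A), x.dualBasis i) := by
    refine Prod.ext ?_ ?_
    · simp [Prod.fst_sum]
    · simp only [Prod.snd_add, Prod.snd_sum, zero_add, Prod.smul_snd]
      exact h
  conv_lhs => rw [h2]
  have h3 : ∀ i, ζ (v.2 (x i) • ((0 : A), x.dualBasis i)) =
      v.2 (x i) * ζ (0, x.dualBasis i) := fun i => by rw [map_smul, smul_eq_mul]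
  simp only [map_add, map_sum, h3, dualToDouble_apply, LinearMap.comp_apply, LinearMap.inl_apply,
    map_smul, smul_eq_mul]
  simp only [mul_comm]

theorem dualToDouble_injective [Fintype ι] [DecidableEq ι] (x : Module.Basis ι F A) :
    Function.Injective (dualToDouble x) := by
  intro ζ ζ' h
  refine LinearMap.ext fun w => ?_
  rw [dualToDouble_pairing x ζ, h, ← dualToDouble_pairing x ζ']

/-- The canonical symmetric bilinear form of `A × A*` is invariant. -/
theorem semidirectBracket_invariant {b : TernaryOp F A} (h : IsThreeLieBracket b)
    (u v p q : A × Module.Dual F A) :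
    u.2 (semidirectBracket b v p q).1 + (semidirectBracket b v p q).2 u.1 =
      -(v.2 (semidirectBracket b u p q).1 + (semidirectBracket b u p q).2 v.1) := by
  simp only [semidirectBracket_apply, LinearMap.add_apply, coad_apply]
  -- Invariance uses only that `b` is alternating: each functional is evaluated on the same three
  -- vectors on both sides, up to order.
  have e1 := congrArg u.2 (h.rotate v.1 p.1 q.1)
  have e2 := congrArg v.2 (h.rotate u.1 p.1 q.1)
  have e3 := congrArg q.2 ((h.rotate v.1 p.1 u.1).trans (h.swap_left p.1 u.1 v.1))
  have e4 := congrArg p.2 ((h.swap_right q.1 v.1 u.1))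
  simp only [map_neg] at e1 e2 e3 e4
  linear_combination e1 + e2 - e3 - e4

/-- The extension of `D` to `A × A*` that is skew for the canonical form. -/
def doubleMap (D : A →ₗ[F] A) : (A × Module.Dual F A) →ₗ[F] (A × Module.Dual F A) :=
  LinearMap.prodMap D (-D.dualMap)

theorem doubleMap_apply (D : A →ₗ[F] A) (p : A × Module.Dual F A) :
    doubleMap D p = (D p.1, -(p.2 ∘ₗ D)) := rfl

theorem IsInvolutiveDerivation.double {b : TernaryOp F A} {D : A →ₗ[F] A}
    (h : IsInvolutiveDerivation b D) :
    IsInvolutiveDerivation (semidirectBracket b) (doubleMap D) where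
  leibniz p q r := by
    refine Prod.ext (h.leibniz _ _ _) (LinearMap.ext fun c => ?_)
    have e1 := congrArg r.2 (h.leibniz p.1 q.1 c)
    have e2 := congrArg p.2 (h.leibniz q.1 r.1 c)
    have e3 := congrArg q.2 (h.leibniz r.1 p.1 c)
    simp only [semidirectBracket_apply, doubleMap_apply, LinearMap.add_apply, coad_apply,
      Prod.snd_add, LinearMap.neg_apply, LinearMap.comp_apply, map_add] at e1 e2 e3 ⊢
    linear_combination -e1 - e2 - e3
  involutive p := by
    refine Prod.ext (h.involutive _) (LinearMap.ext fun c => ?_)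
    simp [doubleMap_apply, h.involutive]

theorem IsInvolutiveDerivation.sum_two [CharZero F] {b : TernaryOp F A} {D : A →ₗ[F] A}
    (h : IsInvolutiveDerivation b D) (x y z : A) :
    b x (D y) (D z) + b (D x) y (D z) + b (D x) (D y) z = -b x y z := by
  -- In `D²[x, y, z]` each argument receives `D²` once, which gives `3[x, y, z]`, and each term with
  -- `D` on two arguments occurs twice. Equality with `[x, y, z]` leaves twice the claim.
  have e := h.involutive (b x y z)
  simp only [h.leibniz, map_add, h.involutive] at e
  have h2 : (2 : F) ≠ 0 := by norm_num
  rw [← sub_eq_zero]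
  refine (smul_eq_zero.1 (?_ : (2 : F) • (_ : A) = 0)).resolve_left h2
  linear_combination (norm := module) e

end Double

/-! ### Functionals on the tensor cube -/

section TensorPairing

variable {F L : Type*} [Field F] [AddCommGroup L] [Module F L]

/-- The pairing of `ξ ⊗ η ⊗ ζ` with the tensor cube. -/
def cubePairing (ξ η ζ : Module.Dual F L) : TensorCube F L →ₗ[F] F :=
  TensorProduct.dualDistrib F L (L ⊗[F] L) (ξ ⊗ₜ[F] TensorProduct.dualDistrib F L L (η ⊗ₜ[F] ζ))

theorem dualOperation_eq_cubePairing (Δ : L →ₗ[F] TensorCube F L) (ξ η ζ : Module.Dual F L)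
    (v : L) : dualOperation Δ ξ η ζ v = cubePairing ξ η ζ (Δ v) := rfl

@[simp]
theorem cubePairing_tmul (ξ η ζ : Module.Dual F L) (a b c : L) :
    cubePairing ξ η ζ (a ⊗ₜ[F] (b ⊗ₜ[F] c)) = ξ a * (η b * ζ c) := by
  simp [cubePairing]

theorem TensorCube.hom_ext {V : Type*} [AddCommGroup V] [Module F V]
    {f g : TensorCube F L →ₗ[F] V}
    (h : ∀ a b c, f (a ⊗ₜ[F] (b ⊗ₜ[F] c)) = g (a ⊗ₜ[F] (b ⊗ₜ[F] c))) : f = g := by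
  refine TensorProduct.ext' fun a s => ?_
  induction s with
  | zero => simp only [TensorProduct.tmul_zero, map_zero]
  | tmul b c => exact h a b c
  | add s s' hs hs' => rw [TensorProduct.tmul_add, map_add, map_add, hs, hs']

theorem cubePairing_phi12 (ξ η ζ : Module.Dual F L) (t : TensorCube F L) :
    cubePairing ξ η ζ (phi12 F L t) = cubePairing η ξ ζ t := by
  refine LinearMap.congr_fun (f := cubePairing ξ η ζ ∘ₗ phi12 F L)
    (TensorCube.hom_ext fun a b c => ?_) t
  simp only [LinearMap.comp_apply, phi12_tmul, cubePairing_tmul]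
  ring

theorem cubePairing_phi13 (ξ η ζ : Module.Dual F L) (t : TensorCube F L) :
    cubePairing ξ η ζ (phi13 F L t) = cubePairing ζ η ξ t := by
  refine LinearMap.congr_fun (f := cubePairing ξ η ζ ∘ₗ phi13 F L)
    (TensorCube.hom_ext fun a b c => ?_) t
  simp only [LinearMap.comp_apply, phi13_tmul, cubePairing_tmul]
  ring

/-- The coordinates in the product basis are themselves pairings with triples of coordinate
functionals, so decomposable functionals separate points. -/
theorem cubePairing_separates {κ : Type*} (B : Module.Basis κ F L) {t t' : TensorCube F L}
    (h : ∀ ξ η ζ, cubePairing ξ η ζ t = cubePairing ξ η ζ t') : t = t' := by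
  refine (B.tensorProduct (B.tensorProduct B)).ext_elem fun i => ?_
  have key : (B.tensorProduct (B.tensorProduct B)).coord i =
      cubePairing (B.coord i.1) (B.coord i.2.1) (B.coord i.2.2) := by
    refine TensorCube.hom_ext fun a b c => ?_
    obtain ⟨i, j, k⟩ := i
    simp only [Module.Basis.coord_apply, Module.Basis.tensorProduct_repr_tmul_apply, smul_eq_mul,
      cubePairing_tmul]
    ring
  have := h (B.coord i.1) (B.coord i.2.1) (B.coord i.2.2)
  rwa [← key] at this

theorem eq_of_dualOperation_eq {κ : Type*} (B : Module.Basis κ F L)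
    (Δ Δ' : L →ₗ[F] TensorCube F L) (h : dualOperation Δ = dualOperation Δ') : Δ = Δ' := by
  refine LinearMap.ext fun v => cubePairing_separates B fun ξ η ζ => ?_
  rw [← dualOperation_eq_cubePairing, h, dualOperation_eq_cubePairing]

/-- The cyclic shift intertwines the action on the first factor with that on the second. With the
next lemma, this carries the cocycle property from `Δ₁` to `Δ₂` and `Δ₃`. -/
theorem lTensor_rTensor_phi (f : L →ₗ[F] L) (t : TensorCube F L) :
    (f.rTensor L).lTensor L (phi13 F L (phi12 F L t)) =
      phi13 F L (phi12 F L (f.rTensor (L ⊗[F] L) t)) := by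
  refine LinearMap.congr_fun (f := (f.rTensor L).lTensor L ∘ₗ phi13 F L ∘ₗ phi12 F L)
    (g := phi13 F L ∘ₗ phi12 F L ∘ₗ f.rTensor (L ⊗[F] L)) (TensorCube.hom_ext fun a b c => ?_) t
  simp [phi12_tmul, phi13_tmul]

theorem lTensor_lTensor_phi (f : L →ₗ[F] L) (t : TensorCube F L) :
    (f.lTensor L).lTensor L (phi12 F L (phi13 F L t)) =
      phi12 F L (phi13 F L (f.rTensor (L ⊗[F] L) t)) := by
  refine LinearMap.congr_fun (f := (f.lTensor L).lTensor L ∘ₗ phi12 F L ∘ₗ phi13 F L)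
    (g := phi12 F L ∘ₗ phi13 F L ∘ₗ f.rTensor (L ⊗[F] L)) (TensorCube.hom_ext fun a b c => ?_) t
  simp [phi12_tmul, phi13_tmul]

end TensorPairing

/-! ### The coproduct induced by an involutive derivation -/

section Induced

variable {F A ι : Type*} [Field F] [AddCommGroup A] [Module F A] [Fintype ι] [DecidableEq ι]
  (x : Module.Basis ι F A) {b : TernaryOp F A} {D : A →ₗ[F] A}

theorem inducedDelta₁_apply (b : TernaryOp F A) (D : A →ₗ[F] A) (v : A × Module.Dual F A) :
    inducedDelta₁ x b D v = ∑ i, ∑ j,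
      (semidirectBracket b v (0, x.dualBasis i) (-(D (x j), 0)) ⊗ₜ[F]
          ((0, x.dualBasis j) ⊗ₜ[F] (D (x i), 0))
        + semidirectBracket b v (-(D (x i), 0)) (0, x.dualBasis j) ⊗ₜ[F]
          ((D (x j), 0) ⊗ₜ[F] (0, x.dualBasis i))
        + semidirectBracket b v (D (x i), 0) (D (x j), 0) ⊗ₜ[F]
          ((0, x.dualBasis j) ⊗ₜ[F] (0, x.dualBasis i))) := rfl

theorem isOneCocycle_inducedDelta₁ (h : IsThreeLieBracket (semidirectBracket b))
    (D : A →ₗ[F] A) : IsOneCocycle (V := TensorCube F (A × Module.Dual F A)) (semidirectBracket b)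
      (fun p q => (semidirectBracket b p q).rTensor
        ((A × Module.Dual F A) ⊗[F] (A × Module.Dual F A))) (inducedDelta₁ x b D) := by
  intro p q r
  simp only [inducedDelta₁_apply, map_sum, map_add, LinearMap.rTensor_tmul,
    ← Finset.sum_add_distrib]
  refine Finset.sum_congr rfl fun i _ => Finset.sum_congr rfl fun j _ => ?_
  simp only [h.isOneCocycle_of_ad, TensorProduct.add_tmul]
  abel

theorem isOneCocycle_inducedDelta₂ (h : IsThreeLieBracket (semidirectBracket b))
    (D : A →ₗ[F] A) :
    IsOneCocycle (V := TensorCube F (A × Module.Dual F A)) (semidirectBracket b)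
      (fun p q => ((semidirectBracket b p q).rTensor (A × Module.Dual F A)).lTensor
        (A × Module.Dual F A)) (inducedDelta₂ x b D) := by
  intro p q r
  simp only [inducedDelta₂, LinearMap.comp_apply, lTensor_rTensor_phi]
  rw [isOneCocycle_inducedDelta₁ x h D p q r]
  simp only [map_add]

theorem isOneCocycle_inducedDelta₃ (h : IsThreeLieBracket (semidirectBracket b))
    (D : A →ₗ[F] A) : IsOneCocycle (V := TensorCube F (A × Module.Dual F A)) (semidirectBracket b)
      (fun p q => ((semidirectBracket b p q).lTensor (A × Module.Dual F A)).lTensor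
        (A × Module.Dual F A)) (inducedDelta₃ x b D) := by
  intro p q r
  simp only [inducedDelta₃, LinearMap.comp_apply, lTensor_lTensor_phi]
  rw [isOneCocycle_inducedDelta₁ x h D p q r]
  simp only [map_add]

theorem doubleMap_dualToDouble (D : A →ₗ[F] A) (ζ : Module.Dual F (A × Module.Dual F A)) :
    doubleMap D (dualToDouble x ζ) = ∑ i, (ζ (0, x.dualBasis i) • (D (x i), (0 : Module.Dual F A))
      - ζ (D (x i), 0) • ((0 : A), x.dualBasis i)) := by
  refine Prod.ext ?_ (x.ext fun j => ?_)
  · simp [doubleMap_apply, dualToDouble_apply, Prod.fst_sum]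
  · simp [doubleMap_apply, dualToDouble_apply, Prod.snd_sum, LinearMap.sum_apply,
      Finsupp.single_apply]

/-- Expanding both copies of `doubleMap D (dualToDouble x ·)` in the basis gives four kinds of
terms, three of which are the summands of `Δ₁`. The functionals `ζ` and `η` appear in reversed order
because the index `i` of the second argument of `μ` belongs to the third tensor factor. -/
theorem cubePairing_inducedDelta₁ (b : TernaryOp F A) (D : A →ₗ[F] A)
    (ξ η ζ : Module.Dual F (A × Module.Dual F A)) (v : A × Module.Dual F A) :
    cubePairing ξ η ζ (inducedDelta₁ x b D v) = ξ (semidirectBracket b v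
      (doubleMap D (dualToDouble x ζ)) (doubleMap D (dualToDouble x η))) := by
  -- The fourth kind of term vanishes: `A*` is an abelian ideal.
  have h0 : ∀ f g, semidirectBracket b v (0, f) (0, g) = 0 := fun f g => by
    refine Prod.ext (by simp [semidirectBracket_apply]) (LinearMap.ext fun c => ?_)
    simp [semidirectBracket_apply, coad_apply]
  have h1 : ∀ P Q : ι → A × Module.Dual F A, ξ (semidirectBracket b v (∑ i, P i) (∑ j, Q j)) =
      ∑ i, ∑ j, ξ (semidirectBracket b v (P i) (Q j)) := fun P Q => by
    simp only [map_sum, LinearMap.sum_apply]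
    exact Finset.sum_comm
  rw [doubleMap_dualToDouble, doubleMap_dualToDouble, h1, inducedDelta₁_apply, map_sum]
  refine Finset.sum_congr rfl fun i _ => ?_
  rw [map_sum]
  refine Finset.sum_congr rfl fun j _ => ?_
  simp only [map_add, cubePairing_tmul, map_sub, LinearMap.sub_apply, map_smul,
    LinearMap.smul_apply, h0, map_neg, LinearMap.neg_apply, smul_eq_mul, map_zero]
  ring

theorem dualOperation_inducedDelta [CharZero F] (hb : IsThreeLieBracket b)
    (hD : IsInvolutiveDerivation b D) (ξ η ζ : Module.Dual F (A × Module.Dual F A))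
    (v : A × Module.Dual F A) :
    dualOperation (inducedDelta₁ x b D + inducedDelta₂ x b D + inducedDelta₃ x b D) ξ η ζ v =
      -((semidirectBracket b (dualToDouble x ξ) (dualToDouble x η) (dualToDouble x ζ)).2 v.1 +
        v.2 (semidirectBracket b (dualToDouble x ξ) (dualToDouble x η) (dualToDouble x ζ)).1) := by
  have e := hD.double.sum_two (dualToDouble x ξ) (dualToDouble x η) (dualToDouble x ζ)
  have inv : ∀ u p q : A × Module.Dual F A, u.2 (semidirectBracket b v p q).1 +
      (semidirectBracket b v p q).2 u.1 = v.2 (-semidirectBracket b u p q).1 +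
        (-semidirectBracket b u p q).2 v.1 := fun u p q => by
    rw [semidirectBracket_invariant hb, Prod.fst_neg, Prod.snd_neg, map_neg, LinearMap.neg_apply,
      neg_add]
  have hs := hb.semidirect
  rw [dualOperation_eq_cubePairing, LinearMap.add_apply, LinearMap.add_apply, map_add, map_add,
    inducedDelta₂, inducedDelta₃, LinearMap.comp_apply, LinearMap.comp_apply, LinearMap.comp_apply,
    LinearMap.comp_apply, cubePairing_phi13, cubePairing_phi12, cubePairing_phi12,
    cubePairing_phi13, cubePairing_inducedDelta₁, cubePairing_inducedDelta₁,
    cubePairing_inducedDelta₁, dualToDouble_pairing x ξ, dualToDouble_pairing x η,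
    dualToDouble_pairing x ζ]
  generalize dualToDouble x ξ = p at *
  generalize dualToDouble x η = q at *
  generalize dualToDouble x ζ = r at *
  -- Invariance moves `v` out of the bracket; skew-symmetry then brings the three terms to the order
  -- in which `sum_two` applies.
  rw [inv, inv, inv, hs.swap_right p, hs.swap_left q, hs.rotate r, hs.swap_left _ _ r]
  simp only [neg_neg]
  have e1 := congrArg (fun w => v.2 w.1) e
  have e2 := congrArg (fun w => w.2 v.1) e
  simp only [Prod.fst_add, Prod.snd_add, Prod.fst_neg, Prod.snd_neg, map_add, map_neg,
    LinearMap.add_apply, LinearMap.neg_apply] at e1 e2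
  linear_combination e1 + e2

theorem dualToDouble_dualOperation [CharZero F] (hb : IsThreeLieBracket b)
    (hD : IsInvolutiveDerivation b D) (ξ η ζ : Module.Dual F (A × Module.Dual F A)) :
    dualToDouble x
        (dualOperation (inducedDelta₁ x b D + inducedDelta₂ x b D + inducedDelta₃ x b D) ξ η ζ) =
      -semidirectBracket b (dualToDouble x ξ) (dualToDouble x η) (dualToDouble x ζ) := by
  have key : ∀ v : A × Module.Dual F A, (dualToDouble x
        (dualOperation (inducedDelta₁ x b D + inducedDelta₂ x b D + inducedDelta₃ x b D)
          ξ η ζ)).2 v.1 + v.2 (dualToDouble x (dualOperation (inducedDelta₁ x b D +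
            inducedDelta₂ x b D + inducedDelta₃ x b D) ξ η ζ)).1 = _ := fun v =>
    (dualToDouble_pairing x _ v).symm.trans (dualOperation_inducedDelta x hb hD ξ η ζ v)
  refine Prod.ext (x.ext_elem fun i => ?_) (LinearMap.ext fun a => ?_)
  · simpa using key (0, x.coord i)
  · simpa using key (a, 0)

theorem isLocalCocycleBialgebra_induced [CharZero F] (hb : IsThreeLieBracket b)
    (hD : IsInvolutiveDerivation b D) :
    IsLocalCocycleBialgebra (semidirectBracket b)
      (inducedDelta₁ x b D + inducedDelta₂ x b D + inducedDelta₃ x b D)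
      (inducedDelta₁ x b D) (inducedDelta₂ x b D) (inducedDelta₃ x b D) where
  threeLie := hb.semidirect
  decomposition := rfl
  dual_threeLie := hb.semidirect.neg_of_injective (dualToDouble x) (dualToDouble_injective x)
    (dualToDouble_dualOperation x hb hD)
  cocycle₁ := isOneCocycle_inducedDelta₁ x hb.semidirect D
  cocycle₂ := isOneCocycle_inducedDelta₂ x hb.semidirect D
  cocycle₃ := isOneCocycle_inducedDelta₃ x hb.semidirect D

end Induced

/-! ### Table operations in coordinates -/

section Coordinates

variable {F A : Type*} [Field F] [AddCommGroup A] [Module F A]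

theorem lab_one : lab 1 = 0 := rfl
theorem lab_two : lab 2 = 1 := rfl
theorem lab_three : lab 3 = 2 := rfl
theorem lab_four : lab 4 = 3 := rfl
theorem lab_five : lab 5 = 4 := rfl

/-- The minor of the coordinate vectors of `p, q, r` in the rows `i, j, k`. -/
noncomputable def minor {ι : Type*} (x : Module.Basis ι F A) (i j k : ι) (p q r : A) : F :=
  x.repr p i * x.repr q j * x.repr r k + x.repr p j * x.repr q k * x.repr r i +
    x.repr p k * x.repr q i * x.repr r j - x.repr p j * x.repr q i * x.repr r k -
    x.repr p i * x.repr q k * x.repr r j - x.repr p k * x.repr q j * x.repr r i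

theorem altMonomial_coord {ι : Type*} (x : Module.Basis ι F A) (i j k : ι) (v p q r : A) :
    altMonomial (x.coord i) (x.coord j) (x.coord k) v p q r = minor x i j k p q r • v := by
  rw [altMonomial_apply, minor]
  congr 1

theorem repr_basis_apply {ι : Type*} [DecidableEq ι] (x : Module.Basis ι F A) (i j : ι) :
    x.repr (x j) i = if j = i then 1 else 0 := by
  rw [x.repr_self, Finsupp.single_apply]

theorem tableOperation_nil {ι : Type*} (x : Module.Basis ι F A) (p q r : A) :
    tableOperation x [] p q r = 0 := rfl

theorem tableOperation_cons {ι : Type*} (x : Module.Basis ι F A) (i j k : ι) (v : A)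
    (T : List (ι × ι × ι × A)) (p q r : A) : tableOperation x ((i, j, k, v) :: T) p q r =
      minor x i j k p q r • v + tableOperation x T p q r := by
  rw [← altMonomial_coord]
  rfl

theorem tableOperation_alternating {ι : Type*} (x : Module.Basis ι F A)
    (T : List (ι × ι × ι × A)) : (∀ p q, tableOperation x T p p q = 0) ∧
      (∀ p q, tableOperation x T p q q = 0) ∧ ∀ p q, tableOperation x T p q p = 0 := by
  induction T with
  | nil => exact ⟨fun _ _ => rfl, fun _ _ => rfl, fun _ _ => rfl⟩
  | cons e T ih =>
    obtain ⟨i, j, k, v⟩ := e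
    obtain ⟨h1, h2, h3⟩ := ih
    refine ⟨fun p q => ?_, fun p q => ?_, fun p q => ?_⟩ <;>
      simp only [tableOperation_cons, h1, h2, h3, add_zero] <;>
      refine smul_eq_zero_of_left ?_ v <;> rw [minor] <;> ring

end Coordinates

/-! ### The seventeen brackets: Filippov identity, derivations, derived algebras -/

section Families

variable {F A : Type*} [Field F] [AddCommGroup A] [Module F A] (x : Module.Basis (Fin 5) F A)
  (α β s t u : F) (j : Fin 17)

set_option maxHeartbeats 8000000 in
theorem family_filippov (p q y z w : A) :
    let b := (family x α β s t u j).bracket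
    b p q (b y z w) = b (b p q y) z w + b y (b p q z) w + b y z (b p q w) := by
  intro b
  have h : ∀ p q r, b p q r = (family x α β s t u j).bracket p q r := fun _ _ _ => rfl
  -- With `b` opaque, the coordinate formulas `c0`, …, `c4` serve as rewrite rules, and nested
  -- brackets unfold into polynomials in the coordinates of the five vectors.
  clear_value b
  fin_cases j
  all_goals
    simp only [family, data1, data2, data3, data4, data5, data6, data7, data8, data9, data10,
      data11, data12, data13, data14, data15, data16, data17, ofTables, List.map_cons,
      List.map_nil, tableOperation_cons, tableOperation_nil, vec, lab_one, lab_two, lab_three,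
      lab_four, lab_five, add_zero, Fin.zero_eta, Fin.mk_one, Fin.reduceFinMk, Matrix.cons_val] at h
    have c := fun p q r => congrArg x.repr (h p q r)
    have c0 := fun p q r => DFunLike.congr_fun (c p q r) 0
    have c1 := fun p q r => DFunLike.congr_fun (c p q r) 1
    have c2 := fun p q r => DFunLike.congr_fun (c p q r) 2
    have c3 := fun p q r => DFunLike.congr_fun (c p q r) 3
    have c4 := fun p q r => DFunLike.congr_fun (c p q r) 4
    clear c h
    simp only [map_add, map_smul, map_neg, Finsupp.add_apply, Finsupp.smul_apply,
      Finsupp.neg_apply, smul_eq_mul, repr_basis_apply, Fin.reduceEq, reduceIte, mul_zero, mul_one,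
      mul_neg, neg_zero, add_zero, zero_add] at c0 c1 c2 c3 c4
    refine x.ext_elem fun i => ?_
    fin_cases i
    all_goals
      simp only [map_add, Finsupp.add_apply, Fin.zero_eta, Fin.mk_one, Fin.reduceFinMk, c0, c1,
        c2, c3, c4, minor, mul_zero, zero_mul, add_zero, zero_add, sub_zero]
    all_goals ring

theorem family_isThreeLieBracket : IsThreeLieBracket (family x α β s t u j).bracket := by
  obtain ⟨T, hT⟩ : ∃ T, (family x α β s t u j).bracket = tableOperation x T := by
    fin_cases j <;> exact ⟨_, rfl⟩
  obtain ⟨h1, h2, h3⟩ := tableOperation_alternating x T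
  exact ⟨by rwa [hT], by rwa [hT], by rwa [hT], family_filippov x α β s t u j⟩

/-- The diagonal map whose entries are the signs `1, ±1, 1, -1, 1`; the second sign is negative for
the last two families. -/
noncomputable def signDerivation : A →ₗ[F] A :=
  x.constr F fun i => ![(1 : F), if 15 ≤ j then -1 else 1, 1, -1, 1] i • x i

theorem signDerivation_basis (i : Fin 5) : signDerivation x j (x i) =
    ![(1 : F), if 15 ≤ j then -1 else 1, 1, -1, 1] i • x i :=
  x.constr_basis F _ i

theorem signDerivation_repr (p : A) (i : Fin 5) : x.repr (signDerivation x j p) i =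
    ![(1 : F), if 15 ≤ j then -1 else 1, 1, -1, 1] i * x.repr p i := by
  have h : x.coord i ∘ₗ signDerivation x j =
      ![(1 : F), if 15 ≤ j then -1 else 1, 1, -1, 1] i • x.coord i := by
    refine x.ext fun k => ?_
    rw [LinearMap.comp_apply, signDerivation_basis]
    by_cases hk : k = i
    · subst hk
      simp
    · simp [hk]
  exact LinearMap.congr_fun h p

set_option maxHeartbeats 4000000 in
-- A diagonal map is a derivation if, for each listed bracket, the entries of the three arguments
-- add up to the entry of every basis vector in the value. In the first fifteen families each
-- bracket involves `x_4` once and takes its value in the span of `x_1, x_2, x_3`, so `1 + 1 - 1 =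
-- 1`. In the last two families the second sign must be `-1`, as `[x_1, x_2, x_3]` is `x_3` or
-- `x_1`.
theorem signDerivation_leibniz (p q r : A) :
    let b := (family x α β s t u j).bracket
    signDerivation x j (b p q r) = b (signDerivation x j p) q r + b p (signDerivation x j q) r +
      b p q (signDerivation x j r) := by
  intro b
  have h : ∀ p q r, b p q r = (family x α β s t u j).bracket p q r := fun _ _ _ => rfl
  clear_value b
  have d := signDerivation_repr x j
  generalize signDerivation x j = D at d ⊢
  fin_cases j
  all_goals
    simp only [family, data1, data2, data3, data4, data5, data6, data7, data8, data9, data10,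
      data11, data12, data13, data14, data15, data16, data17, ofTables, List.map_cons,
      List.map_nil, tableOperation_cons, tableOperation_nil, vec, lab_one, lab_two, lab_three,
      lab_four, lab_five, add_zero, Fin.zero_eta, Fin.mk_one, Fin.reduceFinMk, Matrix.cons_val] at h
    have c := fun p q r => congrArg x.repr (h p q r)
    have c0 := fun p q r => DFunLike.congr_fun (c p q r) 0
    have c1 := fun p q r => DFunLike.congr_fun (c p q r) 1
    have c2 := fun p q r => DFunLike.congr_fun (c p q r) 2
    have c3 := fun p q r => DFunLike.congr_fun (c p q r) 3
    have c4 := fun p q r => DFunLike.congr_fun (c p q r) 4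
    clear c h
    simp only [map_add, map_smul, map_neg, Finsupp.add_apply, Finsupp.smul_apply,
      Finsupp.neg_apply, smul_eq_mul, repr_basis_apply, Fin.reduceEq, reduceIte, mul_zero, mul_one,
      mul_neg, neg_zero, add_zero, zero_add] at c0 c1 c2 c3 c4
    have d0 := fun p => d p 0
    have d1 := fun p => d p 1
    have d2 := fun p => d p 2
    have d3 := fun p => d p 3
    have d4 := fun p => d p 4
    clear d
    simp [Fin.le_def] at d0 d1 d2 d3 d4
    refine x.ext_elem fun i => ?_
    fin_cases i
    all_goals
      simp only [map_add, Finsupp.add_apply, Fin.zero_eta, Fin.mk_one, Fin.reduceFinMk, d0, d1,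
        d2, d3, d4, c0, c1, c2, c3, c4, minor]
    all_goals ring

theorem isInvolutiveDerivation_signDerivation :
    IsInvolutiveDerivation (family x α β s t u j).bracket (signDerivation x j) where
  leibniz := signDerivation_leibniz x α β s t u j
  involutive p := by
    refine x.ext_elem fun i => ?_
    rw [signDerivation_repr, signDerivation_repr, ← mul_assoc]
    fin_cases i <;> by_cases hj : 15 ≤ j <;> simp [hj]

theorem finrank_derivedAlgebra_le_three (b : TernaryOp F A)
    (h : ∀ p q r, b p q r ∈ Submodule.span F (Set.range ![x 0, x 1, x 2])) :
    Module.finrank F (derivedAlgebra b) ≤ 3 := by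
  have hle : derivedAlgebra b ≤ Submodule.span F (Set.range ![x 0, x 1, x 2]) := by
    refine Submodule.span_le.2 ?_
    rintro _ ⟨p, q, r, rfl⟩
    exact h p q r
  have := Module.Finite.of_basis x
  exact (Submodule.finrank_mono hle).trans (finrank_range_le_card (R := F) ![x 0, x 1, x 2])

theorem family_finrank_le (hj : j ≠ 15) :
    Module.finrank F (derivedAlgebra (family x α β s t u j).bracket) ≤ 3 := by
  refine finrank_derivedAlgebra_le_three x _ ?_
  intro p q r
  have m : ∀ i : Fin 3, ![x 0, x 1, x 2] i ∈ Submodule.span F (Set.range ![x 0, x 1, x 2]) :=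
    fun i => Submodule.subset_span ⟨i, rfl⟩
  have m0 := m 0
  have m1 := m 1
  have m2 := m 2
  simp only [Matrix.cons_val] at m0 m1 m2
  generalize hb : (family x α β s t u j).bracket p q r = v
  have h := hb.symm
  clear hb
  -- From here on only the membership of `x_1, x_2, x_3` and closure under linear combinations
  -- matter.
  generalize Submodule.span F (Set.range ![x 0, x 1, x 2]) = S at *
  clear m
  fin_cases j
  all_goals first
    | exact absurd rfl hj
    | skip
  all_goals
    simp only [family, data1, data2, data3, data4, data5, data6, data7, data8, data9, data10,
      data11, data12, data13, data14, data15, data16, data17, ofTables, List.map_cons,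
      List.map_nil, tableOperation_cons, tableOperation_nil, vec, lab_one, lab_two, lab_three,
      lab_four, lab_five, add_zero, Fin.zero_eta, Fin.mk_one, Fin.reduceFinMk, Matrix.cons_val] at h
    rw [h]
    repeat' first
      | assumption
      | apply Submodule.add_mem
      | apply Submodule.neg_mem
      | apply Submodule.smul_mem

end Families

/-! ### The sixteenth family, and the brackets on the double -/

section FamilyDouble

variable {F A : Type*} [Field F] [AddCommGroup A] [Module F A] (x : Module.Basis (Fin 5) F A)
  (α β s t u : F) (j : Fin 17)

theorem data16_bracket (p q r : A) : (data16 x).bracket p q r = minor x 1 2 3 p q r • -x 1 +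
    (minor x 0 2 3 p q r • x 0 + (minor x 0 1 2 p q r • x 2 + minor x 0 1 3 p q r • -x 3)) := by
  simp only [data16, ofTables, List.map_cons,
      List.map_nil, tableOperation_cons, tableOperation_nil, vec, lab_one, lab_two, lab_three,
      lab_four, add_zero]

theorem derivedAlgebra_data16 : derivedAlgebra (data16 x).bracket =
    Submodule.span F (Set.range fun i : Fin 4 => x i.castSucc) := by
  refine le_antisymm (Submodule.span_le.2 ?_) (Submodule.span_le.2 ?_)
  · rintro _ ⟨p, q, r, rfl⟩
    have m : ∀ i : Fin 4, x i.castSucc ∈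
        Submodule.span F (Set.range fun i : Fin 4 => x i.castSucc) :=
      fun i => Submodule.subset_span ⟨i, rfl⟩
    rw [data16_bracket]
    exact add_mem (Submodule.smul_mem _ _ (neg_mem (m 1))) (add_mem (Submodule.smul_mem _ _ (m 0))
      (add_mem (Submodule.smul_mem _ _ (m 2)) (Submodule.smul_mem _ _ (neg_mem (m 3)))))
  · have m : ∀ p q r, (data16 x).bracket p q r ∈ derivedAlgebra (data16 x).bracket :=
      fun p q r => Submodule.subset_span ⟨p, q, r, rfl⟩
    simp only [data16_bracket] at m
    -- Each of these four brackets is a single basis vector up to sign; `neg_mem` corrects the two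
    -- negative ones.
    have m0 := m (x 0) (x 2) (x 3)
    have m1 := neg_mem (m (x 1) (x 2) (x 3))
    have m2 := m (x 0) (x 1) (x 2)
    have m3 := neg_mem (m (x 0) (x 1) (x 3))
    simp [minor, repr_basis_apply, -Module.Basis.repr_self] at m0 m1 m2 m3
    rintro _ ⟨i, rfl⟩
    fin_cases i
    exacts [m0, m1, m2, m3]

theorem finrank_derivedAlgebra_data16 :
    Module.finrank F (derivedAlgebra (data16 x).bracket) = 4 := by
  rw [derivedAlgebra_data16]
  exact (finrank_span_eq_card (x.linearIndependent.comp _ (Fin.castSucc_injective 4))).trans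
    (Fintype.card_fin 4)

/-- The vector `x_5` occurs in no bracket of this family, hence is central. -/
theorem threeLieCenter_data16_ne_bot : threeLieCenter (data16 x).bracket ≠ ⊥ := by
  refine (Submodule.ne_bot_iff _).2 ⟨x 4, ?_, x.ne_zero 4⟩
  rw [mem_threeLieCenter]
  intro p q
  rw [data16_bracket]
  simp [minor, repr_basis_apply, -Module.Basis.repr_self]

theorem finrank_double (x : Module.Basis (Fin 5) F A) :
    Module.finrank F (A × Module.Dual F A) = 10 := by
  rw [Module.finrank_eq_card_basis (x.prod x.dualBasis)]
  rfl

theorem minor_inl_inl_inl {ι : Type*} [Fintype ι] [DecidableEq ι] (x : Module.Basis ι F A)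
    (i j k : ι) (p q r : A × Module.Dual F A) :
    minor (x.prod x.dualBasis) (Sum.inl i) (Sum.inl j) (Sum.inl k) p q r =
      minor x i j k p.1 q.1 r.1 := by
  simp only [minor, Module.Basis.prod_repr_inl]

/-- Laplace expansion along the row of the covector coordinate, which matches the three coadjoint
terms of the semi-direct bracket. -/
theorem minor_inl_inl_inr {ι : Type*} [Fintype ι] [DecidableEq ι] (x : Module.Basis ι F A)
    (i j k : ι) (p q r : A × Module.Dual F A) :
    minor (x.prod x.dualBasis) (Sum.inl i) (Sum.inl j) (Sum.inr k) p q r =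
      (x.repr p.1 i * x.repr q.1 j - x.repr p.1 j * x.repr q.1 i) * r.2 (x k) +
      (x.repr q.1 i * x.repr r.1 j - x.repr q.1 j * x.repr r.1 i) * p.2 (x k) +
      (x.repr r.1 i * x.repr p.1 j - x.repr r.1 j * x.repr p.1 i) * q.2 (x k) := by
  simp only [minor, Module.Basis.prod_repr_inl, Module.Basis.prod_repr_inr,
    Module.Basis.dualBasis_repr]
  ring

set_option maxHeartbeats 8000000 in
theorem family_psi_apply (p q r : A × Module.Dual F A) : (family x α β s t u j).psi p q r =
    semidirectBracket (family x α β s t u j).bracket p q r := by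
  generalize hb : (family x α β s t u j).bracket = b
  have h : ∀ p q r, b p q r = (family x α β s t u j).bracket p q r := fun _ _ _ => by rw [hb]
  clear hb
  generalize hv : (family x α β s t u j).psi p q r = v
  have hv := hv.symm
  fin_cases j
  all_goals
    simp only [family, data1, data2, data3, data4, data5, data6, data7, data8, data9, data10,
      data11, data12, data13, data14, data15, data16, data17, ofTables, List.map_cons,
      List.map_nil, tableOperation_cons, tableOperation_nil, vec, lab_one, lab_two, lab_three,
      lab_four, lab_five, add_zero, Fin.zero_eta, Fin.mk_one, Fin.reduceFinMk, Matrix.cons_val,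
      covec, List.cons_append, List.nil_append, minor_inl_inl_inl, minor_inl_inl_inr] at h hv
    rw [hv, semidirectBracket_apply]
    refine Prod.ext ?_ (x.ext fun i => ?_)
    · simp [h]
    · simp only [Prod.snd_add, Prod.smul_snd, LinearMap.add_apply, LinearMap.smul_apply,
        coad_apply, h, map_add, map_smul, smul_eq_mul, smul_zero, zero_add, LinearMap.neg_apply,
        map_neg]
      clear h hv
      fin_cases i
      all_goals
        simp only [Fin.zero_eta, Fin.mk_one, Fin.reduceFinMk, Module.Basis.coe_dualBasis,
          Module.Basis.coord_apply, LinearMap.sub_apply,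
          LinearMap.neg_apply, minor, repr_basis_apply, Fin.reduceEq, reduceIte, mul_zero, mul_one,
          add_zero, zero_add, sub_zero]
      all_goals ring

theorem family_psi :
    (family x α β s t u j).psi = semidirectBracket (family x α β s t u j).bracket :=
  LinearMap.ext fun p => LinearMap.ext fun q => LinearMap.ext fun r =>
    family_psi_apply x α β s t u j p q r

end FamilyDouble

/-! ### The listed coproducts -/

section FamilyCoproduct

variable {F A : Type*} [Field F] [AddCommGroup A] [Module F A] (x : Module.Basis (Fin 5) F A)
  (α β s t u : F) (j : Fin 17)

theorem cubePairing_wedge {L : Type*} [AddCommGroup L] [Module F L] (ξ η ζ : Module.Dual F L)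
    (a b c : L) : cubePairing ξ η ζ (wedge F a b c) =
      ξ a * (η b * ζ c) + ξ b * (η c * ζ a) + ξ c * (η a * ζ b) - ξ b * (η a * ζ c) -
        ξ a * (η c * ζ b) - ξ c * (η b * ζ a) := by
  simp only [wedge, map_add, map_sub, cubePairing_tmul]

theorem cubePairing_neg_wedge {L : Type*} [AddCommGroup L] [Module F L] (ξ η ζ : Module.Dual F L)
    (a b c : L) : cubePairing ξ η ζ (-wedge F a b c) = -cubePairing ξ η ζ (wedge F a b c) :=
  (cubePairing ξ η ζ).map_neg _

theorem dualToDouble_fst_repr {ι : Type*} [Fintype ι] [DecidableEq ι] (x : Module.Basis ι F A)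
    (ξ : Module.Dual F (A × Module.Dual F A)) (i : ι) :
    x.repr (dualToDouble x ξ).1 i = ξ (0, x.dualBasis i) := by
  rw [dualToDouble_apply, x.repr_sum_self]

theorem dualToDouble_snd_apply {ι : Type*} [Fintype ι] [DecidableEq ι] (x : Module.Basis ι F A)
    (ξ : Module.Dual F (A × Module.Dual F A)) (a : A) :
    (dualToDouble x ξ).2 a = ξ (a, 0) := rfl

set_option maxHeartbeats 8000000 in
-- The listed coproduct is dual to `-μ`, like the induced one, so the comparison requires no
-- derivation. Both sides are polynomials in the values of `ξ, η, ζ` on the ten basis vectors.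
theorem cubePairing_family_coproduct (ξ η ζ : Module.Dual F (A × Module.Dual F A)) (i : Fin 5) :
    let μ := semidirectBracket (family x α β s t u j).bracket (dualToDouble x ξ)
      (dualToDouble x η) (dualToDouble x ζ)
    cubePairing ξ η ζ ((family x α β s t u j).coproduct (x i, 0)) = -μ.2 (x i) ∧
      cubePairing ξ η ζ ((family x α β s t u j).coproduct (0, x.dualBasis i)) =
        -x.repr μ.1 i := by
  intro μ
  have hμ : μ = semidirectBracket (family x α β s t u j).bracket (dualToDouble x ξ)
      (dualToDouble x η) (dualToDouble x ζ) := rfl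
  clear_value μ
  rw [semidirectBracket_apply] at hμ
  generalize hb : (family x α β s t u j).bracket = b at hμ
  have h : ∀ p q r, b p q r = (family x α β s t u j).bracket p q r := fun _ _ _ => by rw [hb]
  clear hb
  subst hμ
  generalize hv : (family x α β s t u j).coproduct = Δ
  have hv (k) : Δ (x.prod x.dualBasis k) =
      (family x α β s t u j).coproduct (x.prod x.dualBasis k) := by rw [hv]
  fin_cases j
  all_goals
    simp only [family, data1, data2, data3, data4, data5, data6, data7, data8, data9, data10,
      data11, data12, data13, data14, data15, data16, data17, ofTables, List.map_cons,
      List.map_nil, tableOperation_cons, tableOperation_nil, vec, lab_one, lab_two, lab_three,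
      lab_four, lab_five, add_zero, Fin.zero_eta, Fin.mk_one, Fin.reduceFinMk, Matrix.cons_val,
      Module.Basis.constr_basis] at h hv
    have hX := hv (Sum.inl i)
    have hY := hv (Sum.inr i)
    simp only [Module.Basis.prod_apply, Sum.elim_inl, Sum.elim_inr, Function.comp_apply,
      LinearMap.inl_apply, LinearMap.inr_apply] at hX hY
    rw [hX, hY]
    clear hX hY hv
    fin_cases i
    all_goals
      simp only [Fin.zero_eta, Fin.mk_one, Fin.reduceFinMk, Matrix.cons_val, cubePairing_wedge,
        cubePairing_neg_wedge, map_add, map_neg, map_sub, map_smul, map_zero, gen, cogen, vec, covec, lab_one, lab_two, lab_three,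
        lab_four, lab_five, LinearMap.add_apply, coad_apply, h, dualToDouble_snd_apply]
      clear h
    all_goals refine ⟨?_, ?_⟩
    all_goals
      simp only [Finsupp.add_apply, Finsupp.smul_apply,
        Finsupp.neg_apply, minor, dualToDouble_fst_repr, repr_basis_apply, Fin.reduceEq, reduceIte,
        smul_eq_mul, mul_zero, mul_one, add_zero, zero_add, sub_zero]
    all_goals ring

theorem family_coproduct [CharZero F] : (family x α β s t u j).coproduct =
    inducedDelta₁ x (family x α β s t u j).bracket (signDerivation x j) +
      inducedDelta₂ x (family x α β s t u j).bracket (signDerivation x j) +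
      inducedDelta₃ x (family x α β s t u j).bracket (signDerivation x j) := by
  refine eq_of_dualOperation_eq (x.prod x.dualBasis) _ _ (LinearMap.ext fun ξ =>
    LinearMap.ext fun η => LinearMap.ext fun ζ => (x.prod x.dualBasis).ext fun k => ?_)
  rw [dualOperation_eq_cubePairing, dualOperation_inducedDelta x
    (family_isThreeLieBracket x α β s t u j) (isInvolutiveDerivation_signDerivation x α β s t u j)]
  rcases k with i | i
  · simpa [Module.Basis.prod_apply] using
      (cubePairing_family_coproduct x α β s t u j ξ η ζ i).1
  · simpa [Module.Basis.prod_apply] using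
      (cubePairing_family_coproduct x α β s t u j ξ η ζ i).2

end FamilyCoproduct

/-! ### The theorem -/

theorem theorem4p4 {F A : Type*} [Field F] [IsAlgClosed F] [CharZero F] [AddCommGroup A]
    [Module F A] (x : Module.Basis (Fin 5) F A) (α β s t u : F) (j : Fin 17) :
    let b : TernaryOp F A := (family x α β s t u j).bracket
    let ψ : TernaryOp F (A × Module.Dual F A) := (family x α β s t u j).psi
    let Δ := (family x α β s t u j).coproduct
    IsThreeLieBracket b ∧
    (Module.finrank F (derivedAlgebra b) ≤ 3 ∨
      (Module.finrank F (derivedAlgebra b) = 4 ∧ threeLieCenter b ≠ ⊥)) ∧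
    Module.finrank F (A × Module.Dual F A) = 10 ∧
    ψ = semidirectBracket b ∧
    ∃ D : A →ₗ[F] A, IsInvolutiveDerivation b D ∧
      IsLocalCocycleBialgebra ψ Δ (inducedDelta₁ x b D) (inducedDelta₂ x b D)
        (inducedDelta₃ x b D) := by
  intro b ψ Δ
  have hb : IsThreeLieBracket b := family_isThreeLieBracket x α β s t u j
  have hD : IsInvolutiveDerivation b (signDerivation x j) :=
    isInvolutiveDerivation_signDerivation x α β s t u j
  have hψ : ψ = semidirectBracket b := family_psi x α β s t u j
  have hΔ : Δ = inducedDelta₁ x b (signDerivation x j) + inducedDelta₂ x b (signDerivation x j) +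
      inducedDelta₃ x b (signDerivation x j) := family_coproduct x α β s t u j
  refine ⟨hb, ?_, finrank_double x, hψ, signDerivation x j, hD, ?_⟩
  -- Indices start at 0, so `j = 15` is the sixteenth family, the only one with a derived algebra of
  -- dimension 4.
  · by_cases hj : j = 15
    · subst hj
      exact Or.inr ⟨finrank_derivedAlgebra_data16 x, threeLieCenter_data16_ne_bot x⟩
    · exact Or.inl (family_finrank_le x α β s t u j hj)
  · rw [hψ, hΔ]
    exact isLocalCocycleBialgebra_induced x hb hD
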